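/- **Theorem 1.** Let $L$ be a complex simple Lie algebra of type $E_6$, $H$ a Cartan subalgebra, $\Phi$ the root system of $L$ relative to $H$, and $a,b,c,d,e,f$ a base of simple roots of $\Phi$, labelled so that the Dynkin diagram is the chain $a-c-d-e-f$ with $b$ joined to $d$. Write $n_1n_2n_3n_4n_5n_6$ for the root $n_1a+n_2b+n_3c+n_4d+n_5e+n_6f$ (for example $112210=a+b+2c+2d+e$). On the real span of the simple roots put $x\prec y$ if the first non-zero coefficient of $y-x$, expanded in terms of $f,e,b,d,c,a$ in this order, is positive. A pair $(r,s)$ of roots is *special* if $r+s\in\Phi$ and $0\prec r\prec s$, and *extraspecial* if moreover $r\preceq r'$ for every special pair $(r',s')$ with $r'+s'=r+s$. Let $\{e_r\}_{r\in\Phi}$ be the root vectors of a Chevalley basis of $L$: $e_r$ lies in the root space of $r$, $[e_r,e_{-r}]=h_r$ is the coroot of $r$, and $[e_r,e_s]=N_{r,s}e_{r+s}$ with $N_{r,s}=\pm(p+1)$ if $r,s,r+s\in\Phi$, where $p$ is the largest integer with $s-pr\in\Phi$ (so that $N_{r,s}=\pm1$ for $E_6$); put $N_{r,s}=0$ if $r+s\notin\Phi$.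 There are exactly 30 extraspecial pairs, those of Table 2. Suppose that $N_{r,s}$ has on them the values $\alpha_0,\dots,\alpha_9$, $\beta_1,\dots,\beta_9$, $\gamma_1,\dots,\gamma_6$, $\delta_1,\delta_2,\delta_3$, $\varepsilon_1,\varepsilon_2$ named in Table 2. Then: 1. $N_{r,s}$ has the value given in Table 3 for every pair $(r,s)$ listed there, and $N_{r,-s}$ has the value given in Table 4 for every pair $(r,s)$ listed there; 2. these are all the non-zero ones: if $r,s\in\Phi$ and $0\prec r\prec s$, then $N_{r,s}\neq0$ if and only if $(r,s)$ is listed in Table 2 or in Table 3, and $N_{r,-s}\ne0$ if and only if $(r,s)$ is listed in Table 4. In the tables, $\theta_{ij\dots}$ means the product $\theta_i\theta_j\cdots$ (for $\theta=\alpha,\beta,\gamma,\delta,\varepsilon$). Each line is for one root $r$; its entries have the form "$s\colon$ value". **Table 2** (values of $N_{r,s}$ on the extraspecial pairs). $r=100000$: $001000\colon \alpha_{1}$; $001100\colon \alpha_{2}$; $011100\colon \alpha_{3}$; $001110\colon \alpha_{4}$; $011110\colon \alpha_{5}$; $011210\colon \alpha_{6}$; $001111\colon \alpha_{7}$; $011111\colon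 \alpha_{8}$; $011211\colon \alpha_{9}$; $011221\colon \alpha_{0}$. $r=001000$: $000100\colon \beta_{1}$; $010100\colon \beta_{2}$; $000110\colon \beta_{3}$; $010110\colon \beta_{4}$; $111210\colon \beta_{5}$; $000111\colon \beta_{6}$; $010111\colon \beta_{7}$; $111211\colon \beta_{8}$; $111221\colon \beta_{9}$. $r=000100$: $010000\colon \gamma_{1}$; $000010\colon \gamma_{2}$; $011110\colon \gamma_{3}$; $000011\colon \gamma_{4}$; $011111\colon \gamma_{5}$; $112221\colon \gamma_{6}$. $r=010000$: $000110\colon \delta_{1}$; $000111\colon \delta_{2}$; $112321\colon \delta_{3}$. $r=000010$: $000001\colon \varepsilon_{1}$; $011211\colon \varepsilon_{2}$. **Table 3** (values of $N_{r,s}$). $r=101000$: $000100\colon \alpha_{12}\beta_{1}$; $010100\colon \alpha_{13}\beta_{2}$; $000110\colon \alpha_{14}\beta_{3}$; $010110\colon \alpha_{15}\beta_{4}$; $011210\colon -\alpha_{16}\beta_{5}$; $000111\colon \alpha_{17}\beta_{6}$; $010111\colon \alpha_{18}\beta_{7}$; $011211\colon -\alpha_{19}\beta_{8}$; $011221\colon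 -\alpha_{10}\beta_{9}$. $r=000100$: $111110\colon \alpha_{56}\gamma_{3}$; $111111\colon \alpha_{89}\gamma_{5}$. $r=001100$: $010000\colon \beta_{12}\gamma_{1}$; $000010\colon \beta_{13}\gamma_{2}$; $010110\colon -\beta_{14}\gamma_{3}$; $111110\colon \alpha_{56}\beta_{15}\gamma_{3}$; $000011\colon \beta_{16}\gamma_{4}$; $010111\colon -\beta_{17}\gamma_{5}$; $111111\colon \alpha_{89}\beta_{18}\gamma_{5}$; $111221\colon -\beta_{19}\gamma_{6}$. $r=101100$: $010000\colon \alpha_{23}\beta_{12}\gamma_{1}$; $000010\colon \alpha_{24}\beta_{13}\gamma_{2}$; $010110\colon -\alpha_{26}\beta_{14}\gamma_{3}$; $011110\colon -\alpha_{26}\beta_{15}\gamma_{3}$; $000011\colon \alpha_{27}\beta_{16}\gamma_{4}$; $010111\colon -\alpha_{29}\beta_{17}\gamma_{5}$; $011111\colon -\alpha_{29}\beta_{18}\gamma_{5}$; $011221\colon \alpha_{20}\beta_{19}\gamma_{6}$. $r=010000$: $001110\colon \beta_{34}\delta_{1}$; $101110\colon \alpha_{45}\beta_{34}\delta_{1}$;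 $001111\colon \beta_{67}\delta_{2}$; $101111\colon \alpha_{78}\beta_{67}\delta_{2}$. $r=010100$: $000010\colon -\gamma_{12}\delta_{1}$; $001110\colon \beta_{34}\gamma_{13}\delta_{1}$; $101110\colon \alpha_{46}\beta_{34}\gamma_{13}\delta_{1}$; $000011\colon -\gamma_{14}\delta_{2}$; $001111\colon \beta_{67}\gamma_{15}\delta_{2}$; $101111\colon \alpha_{79}\beta_{67}\gamma_{15}\delta_{2}$; $112221\colon -\gamma_{16}\delta_{3}$. $r=011100$: $000010\colon -\beta_{24}\gamma_{12}\delta_{1}$; $000110\colon -\beta_{24}\gamma_{13}\delta_{1}$; $101110\colon \alpha_{46}\beta_{2345}\gamma_{13}\delta_{1}$; $000011\colon -\beta_{27}\gamma_{14}\delta_{2}$; $000111\colon -\beta_{27}\gamma_{15}\delta_{2}$; $101111\colon \alpha_{79}\beta_{2678}\gamma_{15}\delta_{2}$; $111221\colon \beta_{29}\gamma_{16}\delta_{3}$. $r=111100$: $000010\colon -\alpha_{35}\beta_{24}\gamma_{12}\delta_{1}$; $000110\colon -\alpha_{36}\beta_{24}\gamma_{13}\delta_{1}$; $001110\colon -\alpha_{36}\beta_{2345}\gamma_{13}\delta_{1}$;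 $000011\colon -\alpha_{38}\beta_{27}\gamma_{14}\delta_{2}$; $000111\colon -\alpha_{39}\beta_{27}\gamma_{15}\delta_{2}$; $001111\colon -\alpha_{39}\beta_{2678}\gamma_{15}\delta_{2}$; $011221\colon -\alpha_{30}\beta_{29}\gamma_{16}\delta_{3}$. $r=000010$: $111211\colon \alpha_{90}\varepsilon_{2}$; $112211\colon \alpha_{90}\beta_{89}\varepsilon_{2}$. $r=000110$: $000001\colon \gamma_{24}\varepsilon_{1}$; $011111\colon -\gamma_{25}\varepsilon_{2}$; $111111\colon -\alpha_{80}\gamma_{25}\varepsilon_{2}$; $112211\colon \alpha_{90}\beta_{89}\gamma_{26}\varepsilon_{2}$. $r=001110$: $000001\colon \beta_{36}\gamma_{24}\varepsilon_{1}$; $010111\colon \beta_{37}\gamma_{25}\varepsilon_{2}$; $111111\colon -\alpha_{80}\beta_{39}\gamma_{25}\varepsilon_{2}$; $111211\colon -\alpha_{90}\beta_{39}\gamma_{26}\varepsilon_{2}$. $r=101110$: $000001\colon \alpha_{47}\beta_{36}\gamma_{24}\varepsilon_{1}$; $010111\colon \alpha_{40}\beta_{37}\gamma_{25}\varepsilon_{2}$;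 $011111\colon \alpha_{40}\beta_{39}\gamma_{25}\varepsilon_{2}$; $011211\colon \alpha_{40}\beta_{39}\gamma_{26}\varepsilon_{2}$. $r=010110$: $000001\colon \gamma_{24}\delta_{12}\varepsilon_{1}$; $001111\colon \beta_{67}\gamma_{25}\delta_{12}\varepsilon_{2}$; $101111\colon \alpha_{70}\beta_{67}\gamma_{25}\delta_{12}\varepsilon_{2}$; $112211\colon \alpha_{90}\beta_{89}\gamma_{26}\delta_{13}\varepsilon_{2}$. $r=011110$: $000001\colon \beta_{47}\gamma_{24}\delta_{12}\varepsilon_{1}$; $000111\colon -\beta_{47}\gamma_{25}\delta_{12}\varepsilon_{2}$; $101111\colon \alpha_{70}\beta_{4679}\gamma_{25}\delta_{12}\varepsilon_{2}$; $111211\colon -\alpha_{90}\beta_{49}\gamma_{26}\delta_{13}\varepsilon_{2}$. $r=111110$: $000001\colon \alpha_{58}\beta_{47}\gamma_{24}\delta_{12}\varepsilon_{1}$; $000111\colon -\alpha_{50}\beta_{47}\gamma_{25}\delta_{12}\varepsilon_{2}$; $001111\colon -\alpha_{50}\beta_{4679}\gamma_{25}\delta_{12}\varepsilon_{2}$; $011211\colon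 \alpha_{50}\beta_{49}\gamma_{26}\delta_{13}\varepsilon_{2}$. $r=011210$: $000001\colon \beta_{47}\gamma_{2345}\delta_{12}\varepsilon_{1}$; $000011\colon \beta_{47}\gamma_{2345}\delta_{12}\varepsilon_{2}$; $101111\colon \alpha_{70}\beta_{4679}\gamma_{2356}\delta_{12}\varepsilon_{2}$; $111111\colon \alpha_{80}\beta_{49}\gamma_{2356}\delta_{13}\varepsilon_{2}$. $r=111210$: $000001\colon \alpha_{69}\beta_{47}\gamma_{2345}\delta_{12}\varepsilon_{1}$; $000011\colon \alpha_{60}\beta_{47}\gamma_{2345}\delta_{12}\varepsilon_{2}$; $001111\colon -\alpha_{60}\beta_{4679}\gamma_{2356}\delta_{12}\varepsilon_{2}$; $011111\colon -\alpha_{60}\beta_{49}\gamma_{2356}\delta_{13}\varepsilon_{2}$. $r=112210$: $000001\colon \alpha_{69}\beta_{4578}\gamma_{2345}\delta_{12}\varepsilon_{1}$; $000011\colon \alpha_{60}\beta_{4579}\gamma_{2345}\delta_{12}\varepsilon_{2}$; $000111\colon \alpha_{60}\beta_{4579}\gamma_{2356}\delta_{12}\varepsilon_{2}$; $010111\colon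 \alpha_{60}\beta_{4579}\gamma_{2356}\delta_{13}\varepsilon_{2}$. **Table 4** (values of $N_{r,-s}$). $r=100000$: $101000\colon -\alpha_{1}$; $101100\colon -\alpha_{2}$; $111100\colon -\alpha_{3}$; $101110\colon -\alpha_{4}$; $111110\colon -\alpha_{5}$; $111210\colon -\alpha_{6}$; $101111\colon -\alpha_{7}$; $111111\colon -\alpha_{8}$; $111211\colon -\alpha_{9}$; $111221\colon -\alpha_{0}$. $r=001000$: $101000\colon \alpha_{1}$; $001100\colon -\beta_{1}$; $011100\colon -\beta_{2}$; $001110\colon -\beta_{3}$; $011110\colon -\beta_{4}$; $112210\colon -\beta_{5}$; $001111\colon -\beta_{6}$; $011111\colon -\beta_{7}$; $112211\colon -\beta_{8}$; $112221\colon -\beta_{9}$. $r=101000$: $101100\colon -\alpha_{12}\beta_{1}$; $111100\colon -\alpha_{13}\beta_{2}$; $101110\colon -\alpha_{14}\beta_{3}$; $111110\colon -\alpha_{15}\beta_{4}$; $112210\colon \alpha_{16}\beta_{5}$; $101111\colon -\alpha_{17}\beta_{6}$; $111111\colon -\alpha_{18}\beta_{7}$; $112211\colon \alpha_{19}\beta_{8}$;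 $112221\colon \alpha_{10}\beta_{9}$. $r=000100$: $001100\colon \beta_{1}$; $101100\colon \alpha_{12}\beta_{1}$; $010100\colon -\gamma_{1}$; $000110\colon -\gamma_{2}$; $011210\colon -\gamma_{3}$; $111210\colon -\alpha_{56}\gamma_{3}$; $000111\colon -\gamma_{4}$; $011211\colon -\gamma_{5}$; $111211\colon -\alpha_{89}\gamma_{5}$; $112321\colon -\gamma_{6}$. $r=001100$: $101100\colon \alpha_{2}$; $011100\colon -\beta_{12}\gamma_{1}$; $001110\colon -\beta_{13}\gamma_{2}$; $011210\colon \beta_{14}\gamma_{3}$; $112210\colon -\alpha_{56}\beta_{15}\gamma_{3}$; $001111\colon -\beta_{16}\gamma_{4}$; $011211\colon \beta_{17}\gamma_{5}$; $112211\colon -\alpha_{89}\beta_{18}\gamma_{5}$; $112321\colon \beta_{19}\gamma_{6}$. $r=101100$: $111100\colon -\alpha_{23}\beta_{12}\gamma_{1}$; $101110\colon -\alpha_{24}\beta_{13}\gamma_{2}$; $111210\colon \alpha_{26}\beta_{14}\gamma_{3}$; $112210\colon \alpha_{26}\beta_{15}\gamma_{3}$; $101111\colon -\alpha_{27}\beta_{16}\gamma_{4}$;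 $111211\colon \alpha_{29}\beta_{17}\gamma_{5}$; $112211\colon \alpha_{29}\beta_{18}\gamma_{5}$; $112321\colon -\alpha_{20}\beta_{19}\gamma_{6}$. $r=010000$: $010100\colon \gamma_{1}$; $011100\colon \beta_{12}\gamma_{1}$; $111100\colon \alpha_{23}\beta_{12}\gamma_{1}$; $010110\colon -\delta_{1}$; $011110\colon -\beta_{34}\delta_{1}$; $111110\colon -\alpha_{45}\beta_{34}\delta_{1}$; $010111\colon -\delta_{2}$; $011111\colon -\beta_{67}\delta_{2}$; $111111\colon -\alpha_{78}\beta_{67}\delta_{2}$; $122321\colon -\delta_{3}$. $r=010100$: $011100\colon \beta_{2}$; $111100\colon \alpha_{13}\beta_{2}$; $010110\colon \gamma_{12}\delta_{1}$; $011210\colon -\beta_{34}\gamma_{13}\delta_{1}$; $111210\colon -\alpha_{46}\beta_{34}\gamma_{13}\delta_{1}$; $010111\colon \gamma_{14}\delta_{2}$; $011211\colon -\beta_{67}\gamma_{15}\delta_{2}$; $111211\colon -\alpha_{79}\beta_{67}\gamma_{15}\delta_{2}$; $122321\colon \gamma_{16}\delta_{3}$. $r=011100$: $111100\colon \alpha_{3}$;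 $011110\colon \beta_{24}\gamma_{12}\delta_{1}$; $011210\colon \beta_{24}\gamma_{13}\delta_{1}$; $112210\colon -\alpha_{46}\beta_{2345}\gamma_{13}\delta_{1}$; $011111\colon \beta_{27}\gamma_{14}\delta_{2}$; $011211\colon \beta_{27}\gamma_{15}\delta_{2}$; $112211\colon -\alpha_{79}\beta_{2678}\gamma_{15}\delta_{2}$; $122321\colon -\beta_{29}\gamma_{16}\delta_{3}$. $r=111100$: $111110\colon \alpha_{35}\beta_{24}\gamma_{12}\delta_{1}$; $111210\colon \alpha_{36}\beta_{24}\gamma_{13}\delta_{1}$; $112210\colon \alpha_{36}\beta_{2345}\gamma_{13}\delta_{1}$; $111111\colon \alpha_{38}\beta_{27}\gamma_{14}\delta_{2}$; $111211\colon \alpha_{39}\beta_{27}\gamma_{15}\delta_{2}$; $112211\colon \alpha_{39}\beta_{2678}\gamma_{15}\delta_{2}$; $122321\colon \alpha_{30}\beta_{29}\gamma_{16}\delta_{3}$. $r=000010$: $000110\colon \gamma_{2}$; $001110\colon \beta_{13}\gamma_{2}$; $101110\colon \alpha_{24}\beta_{13}\gamma_{2}$; $010110\colon -\gamma_{12}\delta_{1}$;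 $011110\colon -\beta_{24}\gamma_{12}\delta_{1}$; $111110\colon -\alpha_{35}\beta_{24}\gamma_{12}\delta_{1}$; $000011\colon -\varepsilon_{1}$; $011221\colon -\varepsilon_{2}$; $111221\colon -\alpha_{90}\varepsilon_{2}$; $112221\colon -\alpha_{90}\beta_{89}\varepsilon_{2}$. $r=000110$: $001110\colon \beta_{3}$; $101110\colon \alpha_{14}\beta_{3}$; $010110\colon \delta_{1}$; $011210\colon -\beta_{24}\gamma_{13}\delta_{1}$; $111210\colon -\alpha_{36}\beta_{24}\gamma_{13}\delta_{1}$; $000111\colon -\gamma_{24}\varepsilon_{1}$; $011221\colon \gamma_{25}\varepsilon_{2}$; $111221\colon \alpha_{80}\gamma_{25}\varepsilon_{2}$; $112321\colon -\alpha_{90}\beta_{89}\gamma_{26}\varepsilon_{2}$. $r=001110$: $101110\colon \alpha_{4}$; $011110\colon \beta_{34}\delta_{1}$; $011210\colon \beta_{34}\gamma_{13}\delta_{1}$; $112210\colon -\alpha_{36}\beta_{2345}\gamma_{13}\delta_{1}$; $001111\colon -\beta_{36}\gamma_{24}\varepsilon_{1}$; $011221\colon -\beta_{37}\gamma_{25}\varepsilon_{2}$;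 $112221\colon \alpha_{80}\beta_{39}\gamma_{25}\varepsilon_{2}$; $112321\colon \alpha_{90}\beta_{39}\gamma_{26}\varepsilon_{2}$. $r=101110$: $111110\colon \alpha_{45}\beta_{34}\delta_{1}$; $111210\colon \alpha_{46}\beta_{34}\gamma_{13}\delta_{1}$; $112210\colon \alpha_{46}\beta_{2345}\gamma_{13}\delta_{1}$; $101111\colon -\alpha_{47}\beta_{36}\gamma_{24}\varepsilon_{1}$; $111221\colon -\alpha_{40}\beta_{37}\gamma_{25}\varepsilon_{2}$; $112221\colon -\alpha_{40}\beta_{39}\gamma_{25}\varepsilon_{2}$; $112321\colon -\alpha_{40}\beta_{39}\gamma_{26}\varepsilon_{2}$. $r=010110$: $011110\colon \beta_{4}$; $111110\colon \alpha_{15}\beta_{4}$; $011210\colon -\beta_{14}\gamma_{3}$; $111210\colon -\alpha_{26}\beta_{14}\gamma_{3}$; $010111\colon -\gamma_{24}\delta_{12}\varepsilon_{1}$; $011221\colon -\beta_{67}\gamma_{25}\delta_{12}\varepsilon_{2}$; $111221\colon -\alpha_{70}\beta_{67}\gamma_{25}\delta_{12}\varepsilon_{2}$; $122321\colon -\alpha_{90}\beta_{89}\gamma_{26}\delta_{13}\varepsilon_{2}$.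 $r=011110$: $111110\colon \alpha_{5}$; $011210\colon \gamma_{3}$; $112210\colon -\alpha_{26}\beta_{15}\gamma_{3}$; $011111\colon -\beta_{47}\gamma_{24}\delta_{12}\varepsilon_{1}$; $011221\colon \beta_{47}\gamma_{25}\delta_{12}\varepsilon_{2}$; $112221\colon -\alpha_{70}\beta_{4679}\gamma_{25}\delta_{12}\varepsilon_{2}$; $122321\colon \alpha_{90}\beta_{49}\gamma_{26}\delta_{13}\varepsilon_{2}$. $r=111110$: $111210\colon \alpha_{56}\gamma_{3}$; $112210\colon \alpha_{56}\beta_{15}\gamma_{3}$; $111111\colon -\alpha_{58}\beta_{47}\gamma_{24}\delta_{12}\varepsilon_{1}$; $111221\colon \alpha_{50}\beta_{47}\gamma_{25}\delta_{12}\varepsilon_{2}$; $112221\colon \alpha_{50}\beta_{4679}\gamma_{25}\delta_{12}\varepsilon_{2}$; $122321\colon -\alpha_{50}\beta_{49}\gamma_{26}\delta_{13}\varepsilon_{2}$. $r=011210$: $111210\colon \alpha_{6}$; $112210\colon -\alpha_{16}\beta_{5}$; $011211\colon -\beta_{47}\gamma_{2345}\delta_{12}\varepsilon_{1}$; $011221\colon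 -\beta_{47}\gamma_{2345}\delta_{12}\varepsilon_{2}$; $112321\colon -\alpha_{70}\beta_{4679}\gamma_{2356}\delta_{12}\varepsilon_{2}$; $122321\colon -\alpha_{80}\beta_{49}\gamma_{2356}\delta_{13}\varepsilon_{2}$. $r=111210$: $112210\colon \beta_{5}$; $111211\colon -\alpha_{69}\beta_{47}\gamma_{2345}\delta_{12}\varepsilon_{1}$; $111221\colon -\alpha_{60}\beta_{47}\gamma_{2345}\delta_{12}\varepsilon_{2}$; $112321\colon \alpha_{60}\beta_{4679}\gamma_{2356}\delta_{12}\varepsilon_{2}$; $122321\colon \alpha_{60}\beta_{49}\gamma_{2356}\delta_{13}\varepsilon_{2}$. $r=112210$: $112211\colon -\alpha_{69}\beta_{4578}\gamma_{2345}\delta_{12}\varepsilon_{1}$; $112221\colon -\alpha_{60}\beta_{4579}\gamma_{2345}\delta_{12}\varepsilon_{2}$; $112321\colon -\alpha_{60}\beta_{4579}\gamma_{2356}\delta_{12}\varepsilon_{2}$; $122321\colon -\alpha_{60}\beta_{4579}\gamma_{2356}\delta_{13}\varepsilon_{2}$. $r=000001$: $000011\colon \varepsilon_{1}$; $000111\colon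 \gamma_{24}\varepsilon_{1}$; $001111\colon \beta_{36}\gamma_{24}\varepsilon_{1}$; $101111\colon \alpha_{47}\beta_{36}\gamma_{24}\varepsilon_{1}$; $010111\colon \gamma_{24}\delta_{12}\varepsilon_{1}$; $011111\colon \beta_{47}\gamma_{24}\delta_{12}\varepsilon_{1}$; $111111\colon \alpha_{58}\beta_{47}\gamma_{24}\delta_{12}\varepsilon_{1}$; $011211\colon \beta_{47}\gamma_{2345}\delta_{12}\varepsilon_{1}$; $111211\colon \alpha_{69}\beta_{47}\gamma_{2345}\delta_{12}\varepsilon_{1}$; $112211\colon \alpha_{69}\beta_{4578}\gamma_{2345}\delta_{12}\varepsilon_{1}$. $r=000011$: $000111\colon \gamma_{4}$; $001111\colon \beta_{16}\gamma_{4}$; $101111\colon \alpha_{27}\beta_{16}\gamma_{4}$; $010111\colon -\gamma_{14}\delta_{2}$; $011111\colon -\beta_{27}\gamma_{14}\delta_{2}$; $111111\colon -\alpha_{38}\beta_{27}\gamma_{14}\delta_{2}$; $011221\colon \beta_{47}\gamma_{2345}\delta_{12}\varepsilon_{2}$; $111221\colon \alpha_{60}\beta_{47}\gamma_{2345}\delta_{12}\varepsilon_{2}$;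 $112221\colon \alpha_{60}\beta_{4579}\gamma_{2345}\delta_{12}\varepsilon_{2}$. $r=000111$: $001111\colon \beta_{6}$; $101111\colon \alpha_{17}\beta_{6}$; $010111\colon \delta_{2}$; $011211\colon -\beta_{27}\gamma_{15}\delta_{2}$; $111211\colon -\alpha_{39}\beta_{27}\gamma_{15}\delta_{2}$; $011221\colon -\beta_{47}\gamma_{25}\delta_{12}\varepsilon_{2}$; $111221\colon -\alpha_{50}\beta_{47}\gamma_{25}\delta_{12}\varepsilon_{2}$; $112321\colon \alpha_{60}\beta_{4579}\gamma_{2356}\delta_{12}\varepsilon_{2}$. $r=001111$: $101111\colon \alpha_{7}$; $011111\colon \beta_{67}\delta_{2}$; $011211\colon \beta_{67}\gamma_{15}\delta_{2}$; $112211\colon -\alpha_{39}\beta_{2678}\gamma_{15}\delta_{2}$; $011221\colon \beta_{67}\gamma_{25}\delta_{12}\varepsilon_{2}$; $112221\colon -\alpha_{50}\beta_{4679}\gamma_{25}\delta_{12}\varepsilon_{2}$; $112321\colon -\alpha_{60}\beta_{4679}\gamma_{2356}\delta_{12}\varepsilon_{2}$. $r=101111$: $111111\colon \alpha_{78}\beta_{67}\delta_{2}$;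 $111211\colon \alpha_{79}\beta_{67}\gamma_{15}\delta_{2}$; $112211\colon \alpha_{79}\beta_{2678}\gamma_{15}\delta_{2}$; $111221\colon \alpha_{70}\beta_{67}\gamma_{25}\delta_{12}\varepsilon_{2}$; $112221\colon \alpha_{70}\beta_{4679}\gamma_{25}\delta_{12}\varepsilon_{2}$; $112321\colon \alpha_{70}\beta_{4679}\gamma_{2356}\delta_{12}\varepsilon_{2}$. $r=010111$: $011111\colon \beta_{7}$; $111111\colon \alpha_{18}\beta_{7}$; $011211\colon -\beta_{17}\gamma_{5}$; $111211\colon -\alpha_{29}\beta_{17}\gamma_{5}$; $011221\colon \beta_{37}\gamma_{25}\varepsilon_{2}$; $111221\colon \alpha_{40}\beta_{37}\gamma_{25}\varepsilon_{2}$; $122321\colon \alpha_{60}\beta_{4579}\gamma_{2356}\delta_{13}\varepsilon_{2}$. $r=011111$: $111111\colon \alpha_{8}$; $011211\colon \gamma_{5}$; $112211\colon -\alpha_{29}\beta_{18}\gamma_{5}$; $011221\colon -\gamma_{25}\varepsilon_{2}$; $112221\colon \alpha_{40}\beta_{39}\gamma_{25}\varepsilon_{2}$; $122321\colon -\alpha_{60}\beta_{49}\gamma_{2356}\delta_{13}\varepsilon_{2}$.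 $r=111111$: $111211\colon \alpha_{89}\gamma_{5}$; $112211\colon \alpha_{89}\beta_{18}\gamma_{5}$; $111221\colon -\alpha_{80}\gamma_{25}\varepsilon_{2}$; $112221\colon -\alpha_{80}\beta_{39}\gamma_{25}\varepsilon_{2}$; $122321\colon \alpha_{80}\beta_{49}\gamma_{2356}\delta_{13}\varepsilon_{2}$. $r=011211$: $111211\colon \alpha_{9}$; $112211\colon -\alpha_{19}\beta_{8}$; $011221\colon \varepsilon_{2}$; $112321\colon \alpha_{40}\beta_{39}\gamma_{26}\varepsilon_{2}$; $122321\colon \alpha_{50}\beta_{49}\gamma_{26}\delta_{13}\varepsilon_{2}$. $r=111211$: $112211\colon \beta_{8}$; $111221\colon \alpha_{90}\varepsilon_{2}$; $112321\colon -\alpha_{90}\beta_{39}\gamma_{26}\varepsilon_{2}$; $122321\colon -\alpha_{90}\beta_{49}\gamma_{26}\delta_{13}\varepsilon_{2}$. $r=112211$: $112221\colon \alpha_{90}\beta_{89}\varepsilon_{2}$; $112321\colon \alpha_{90}\beta_{89}\gamma_{26}\varepsilon_{2}$; $122321\colon \alpha_{90}\beta_{89}\gamma_{26}\delta_{13}\varepsilon_{2}$.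 $r=011221$: $111221\colon \alpha_{0}$; $112221\colon -\alpha_{10}\beta_{9}$; $112321\colon \alpha_{20}\beta_{19}\gamma_{6}$; $122321\colon -\alpha_{30}\beta_{29}\gamma_{16}\delta_{3}$. $r=111221$: $112221\colon \beta_{9}$; $112321\colon -\beta_{19}\gamma_{6}$; $122321\colon \beta_{29}\gamma_{16}\delta_{3}$. $r=112221$: $112321\colon \gamma_{6}$; $122321\colon -\gamma_{16}\delta_{3}$. $r=112321$: $122321\colon \delta_{3}$. -/

import Mathlib

open Module LieAlgebra LieAlgebra.IsKilling

noncomputable section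

namespace E6

/-- A Chevalley basis of a complex semisimple Lie algebra `L` relative to a Cartan subalgebra `H`:
root vectors `e_r`, one for each root `r`, with `[e_r, e_{-r}] = h_r` (the coroot of `r`) and
`[e_r, e_s] = N_{r,s} e_{r+s}`, `N_{r,s} = ±(p + 1)`, whenever `r`, `s`, `r + s` are roots, where
`s - p r, …, s, …, s + q r` is the `r`-string through `s`. The `e_r` and the coroots of the
simple roots of any base then form a basis of `L`.

The structure constants are indexed by all linear forms on `H`; they are `0` on those pairs
`(x, y)` for which `x`, `y`, `x + y` are not all roots. -/
structure ChevalleyBasis {L : Type*} [LieRing L] [LieAlgebra ℂ L] [FiniteDimensional ℂ L]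
    [IsKilling ℂ L] (H : LieSubalgebra ℂ L) [H.IsCartanSubalgebra] where
  /-- the root vectors -/
  e : H.root → L
  /-- the structure constants -/
  N : Dual ℂ H → Dual ℂ H → ℤ
  e_mem (r : H.root) : e r ∈ rootSpace H ((rootSystem H).root r)
  lie_of_add_eq_zero (r s : H.root) (h : (rootSystem H).root r + (rootSystem H).root s = 0) :
    ⁅e r, e s⁆ = ((rootSystem H).coroot r : L)
  lie_of_add_eq_root (r s t : H.root)
    (h : (rootSystem H).root r + (rootSystem H).root s = (rootSystem H).root t) :
    ⁅e r, e s⁆ = N ((rootSystem H).root r) ((rootSystem H).root s) • e t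
  N_eq_or (r s t : H.root)
    (h : (rootSystem H).root r + (rootSystem H).root s = (rootSystem H).root t) :
    N ((rootSystem H).root r) ((rootSystem H).root s) = (rootSystem H).chainBotCoeff r s + 1 ∨
    N ((rootSystem H).root r) ((rootSystem H).root s) = -((rootSystem H).chainBotCoeff r s + 1)
  N_eq_zero (x y : Dual ℂ H)
    (h : ¬ (x ∈ Set.range (rootSystem H).root ∧ y ∈ Set.range (rootSystem H).root ∧
      x + y ∈ Set.range (rootSystem H).root)) : N x y = 0

/-- The order `x ≺ y` on the real span of six linearly independent vectors
`p 0, …, p 5 = a, b, c, d, e, f`: in the expansion of `y - x` in terms of `f, e, b, d, c, a`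
(in this order) the first non-zero coefficient is positive. -/
def Prec {V : Type*} [AddCommGroup V] [Module ℂ V] (p : Fin 6 → V) (x y : V) : Prop :=
  ∃ τ ρ : Fin 6 → ℝ,
    x = ∑ i, (τ i : ℂ) • (![p 5, p 4, p 1, p 3, p 2, p 0] : Fin 6 → V) i ∧
    y = ∑ i, (ρ i : ℂ) • (![p 5, p 4, p 1, p 3, p 2, p 0] : Fin 6 → V) i ∧
    ∃ k, (∀ j < k, τ j = ρ j) ∧ τ k < ρ k

/-- A special pair of roots: `r + s` is a root and `0 ≺ r ≺ s`. -/
def IsSpecial {V : Type*} [AddCommGroup V] [Module ℂ V] (Φ : Set V) (p : Fin 6 → V) (r s : V) :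
    Prop :=
  r ∈ Φ ∧ s ∈ Φ ∧ r + s ∈ Φ ∧ Prec p 0 r ∧ Prec p r s

/-- An extraspecial pair: the special pair with the smallest first member among all the special
pairs with the same sum. -/
def IsExtraspecial {V : Type*} [AddCommGroup V] [Module ℂ V] (Φ : Set V) (p : Fin 6 → V)
    (r s : V) : Prop :=
  IsSpecial Φ p r s ∧ ∀ r' s', IsSpecial Φ p r' s' → r' + s' = r + s → r = r' ∨ Prec p r r'

/-- The six-digit notation for roots: `ofDigits p 112210` is `a + b + 2c + 2d + e`, where
`a, b, c, d, e, f = p 0, …, p 5`. -/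
def ofDigits {V : Type*} [AddCommGroup V] (p : Fin 6 → V) (n : ℕ) : V :=
  (n / 100000 % 10) • p 0 + (n / 10000 % 10) • p 1 + (n / 1000 % 10) • p 2 +
    (n / 100 % 10) • p 3 + (n / 10 % 10) • p 4 + (n % 10) • p 5

/-- A table of structure constants consists of rows `(r, [(s, v), …])`, each of which contains the
assertions `N_{r,s} = v`. The assertion `N_{r,s} = v` is listed in `T`. -/
def Listed {V : Type*} (T : List (V × List (V × ℤ))) (r s : V) (v : ℤ) : Prop :=
  ∃ l, (r, l) ∈ T ∧ (s, v) ∈ l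

/-- The prescribed structure constants, on the extraspecial pairs of roots. -/
def table2 {V : Type*} [AddCommGroup V] (p : Fin 6 → V) (α β γ δ ε : ℕ → ℤ) :
    List (V × List (V × ℤ)) :=
  let r := ofDigits p
  [(r 100000, [(r 001000, α 1), (r 001100, α 2), (r 011100, α 3), (r 001110, α 4),
     (r 011110, α 5), (r 011210, α 6), (r 001111, α 7), (r 011111, α 8), (r 011211, α 9),
     (r 011221, α 0)]),
   (r 001000, [(r 000100, β 1), (r 010100, β 2), (r 000110, β 3), (r 010110, β 4),
     (r 111210, β 5), (r 000111, β 6), (r 010111, β 7), (r 111211, β 8), (r 111221, β 9)]),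
   (r 000100, [(r 010000, γ 1), (r 000010, γ 2), (r 011110, γ 3), (r 000011, γ 4),
     (r 011111, γ 5), (r 112221, γ 6)]),
   (r 010000, [(r 000110, δ 1), (r 000111, δ 2), (r 112321, δ 3)]),
   (r 000010, [(r 000001, ε 1), (r 011211, ε 2)])]

/-- The structure constants `N_{r,s}` for the special pairs `(r, s)` that are not extraspecial. -/
def table3 {V : Type*} [AddCommGroup V] (p : Fin 6 → V) (α β γ δ ε : ℕ → ℤ) :
    List (V × List (V × ℤ)) :=
  let r := ofDigits p
  [(r 101000, [(r 000100, α 1*α 2*β 1), (r 010100, α 1*α 3*β 2), (r 000110, α 1*α 4*β 3),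
     (r 010110, α 1*α 5*β 4), (r 011210, -(α 1*α 6*β 5)), (r 000111, α 1*α 7*β 6),
     (r 010111, α 1*α 8*β 7), (r 011211, -(α 1*α 9*β 8)), (r 011221, -(α 1*α 0*β 9))]),
   (r 000100, [(r 111110, α 5*α 6*γ 3), (r 111111, α 8*α 9*γ 5)]),
   (r 001100, [(r 010000, β 1*β 2*γ 1), (r 000010, β 1*β 3*γ 2), (r 010110, -(β 1*β 4*γ 3)),
     (r 111110, α 5*α 6*β 1*β 5*γ 3), (r 000011, β 1*β 6*γ 4), (r 010111, -(β 1*β 7*γ 5)),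
     (r 111111, α 8*α 9*β 1*β 8*γ 5), (r 111221, -(β 1*β 9*γ 6))]),
   (r 101100, [(r 010000, α 2*α 3*β 1*β 2*γ 1), (r 000010, α 2*α 4*β 1*β 3*γ 2),
     (r 010110, -(α 2*α 6*β 1*β 4*γ 3)), (r 011110, -(α 2*α 6*β 1*β 5*γ 3)),
     (r 000011, α 2*α 7*β 1*β 6*γ 4), (r 010111, -(α 2*α 9*β 1*β 7*γ 5)),
     (r 011111, -(α 2*α 9*β 1*β 8*γ 5)), (r 011221, α 2*α 0*β 1*β 9*γ 6)]),
   (r 010000, [(r 001110, β 3*β 4*δ 1), (r 101110, α 4*α 5*β 3*β 4*δ 1), (r 001111, β 6*β 7*δ 2),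
     (r 101111, α 7*α 8*β 6*β 7*δ 2)]),
   (r 010100, [(r 000010, -(γ 1*γ 2*δ 1)), (r 001110, β 3*β 4*γ 1*γ 3*δ 1),
     (r 101110, α 4*α 6*β 3*β 4*γ 1*γ 3*δ 1), (r 000011, -(γ 1*γ 4*δ 2)),
     (r 001111, β 6*β 7*γ 1*γ 5*δ 2), (r 101111, α 7*α 9*β 6*β 7*γ 1*γ 5*δ 2),
     (r 112221, -(γ 1*γ 6*δ 3))]),
   (r 011100, [(r 000010, -(β 2*β 4*γ 1*γ 2*δ 1)), (r 000110, -(β 2*β 4*γ 1*γ 3*δ 1)),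
     (r 101110, α 4*α 6*β 2*β 3*β 4*β 5*γ 1*γ 3*δ 1), (r 000011, -(β 2*β 7*γ 1*γ 4*δ 2)),
     (r 000111, -(β 2*β 7*γ 1*γ 5*δ 2)), (r 101111, α 7*α 9*β 2*β 6*β 7*β 8*γ 1*γ 5*δ 2),
     (r 111221, β 2*β 9*γ 1*γ 6*δ 3)]),
   (r 111100, [(r 000010, -(α 3*α 5*β 2*β 4*γ 1*γ 2*δ 1)),
     (r 000110, -(α 3*α 6*β 2*β 4*γ 1*γ 3*δ 1)),
     (r 001110, -(α 3*α 6*β 2*β 3*β 4*β 5*γ 1*γ 3*δ 1)),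
     (r 000011, -(α 3*α 8*β 2*β 7*γ 1*γ 4*δ 2)), (r 000111, -(α 3*α 9*β 2*β 7*γ 1*γ 5*δ 2)),
     (r 001111, -(α 3*α 9*β 2*β 6*β 7*β 8*γ 1*γ 5*δ 2)),
     (r 011221, -(α 3*α 0*β 2*β 9*γ 1*γ 6*δ 3))]),
   (r 000010, [(r 111211, α 9*α 0*ε 2), (r 112211, α 9*α 0*β 8*β 9*ε 2)]),
   (r 000110, [(r 000001, γ 2*γ 4*ε 1), (r 011111, -(γ 2*γ 5*ε 2)),
     (r 111111, -(α 8*α 0*γ 2*γ 5*ε 2)), (r 112211, α 9*α 0*β 8*β 9*γ 2*γ 6*ε 2)]),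
   (r 001110, [(r 000001, β 3*β 6*γ 2*γ 4*ε 1), (r 010111, β 3*β 7*γ 2*γ 5*ε 2),
     (r 111111, -(α 8*α 0*β 3*β 9*γ 2*γ 5*ε 2)), (r 111211, -(α 9*α 0*β 3*β 9*γ 2*γ 6*ε 2))]),
   (r 101110, [(r 000001, α 4*α 7*β 3*β 6*γ 2*γ 4*ε 1), (r 010111, α 4*α 0*β 3*β 7*γ 2*γ 5*ε 2),
     (r 011111, α 4*α 0*β 3*β 9*γ 2*γ 5*ε 2), (r 011211, α 4*α 0*β 3*β 9*γ 2*γ 6*ε 2)]),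
   (r 010110, [(r 000001, γ 2*γ 4*δ 1*δ 2*ε 1), (r 001111, β 6*β 7*γ 2*γ 5*δ 1*δ 2*ε 2),
     (r 101111, α 7*α 0*β 6*β 7*γ 2*γ 5*δ 1*δ 2*ε 2),
     (r 112211, α 9*α 0*β 8*β 9*γ 2*γ 6*δ 1*δ 3*ε 2)]),
   (r 011110, [(r 000001, β 4*β 7*γ 2*γ 4*δ 1*δ 2*ε 1),
     (r 000111, -(β 4*β 7*γ 2*γ 5*δ 1*δ 2*ε 2)),
     (r 101111, α 7*α 0*β 4*β 6*β 7*β 9*γ 2*γ 5*δ 1*δ 2*ε 2),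
     (r 111211, -(α 9*α 0*β 4*β 9*γ 2*γ 6*δ 1*δ 3*ε 2))]),
   (r 111110, [(r 000001, α 5*α 8*β 4*β 7*γ 2*γ 4*δ 1*δ 2*ε 1),
     (r 000111, -(α 5*α 0*β 4*β 7*γ 2*γ 5*δ 1*δ 2*ε 2)),
     (r 001111, -(α 5*α 0*β 4*β 6*β 7*β 9*γ 2*γ 5*δ 1*δ 2*ε 2)),
     (r 011211, α 5*α 0*β 4*β 9*γ 2*γ 6*δ 1*δ 3*ε 2)]),
   (r 011210, [(r 000001, β 4*β 7*γ 2*γ 3*γ 4*γ 5*δ 1*δ 2*ε 1),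
     (r 000011, β 4*β 7*γ 2*γ 3*γ 4*γ 5*δ 1*δ 2*ε 2),
     (r 101111, α 7*α 0*β 4*β 6*β 7*β 9*γ 2*γ 3*γ 5*γ 6*δ 1*δ 2*ε 2),
     (r 111111, α 8*α 0*β 4*β 9*γ 2*γ 3*γ 5*γ 6*δ 1*δ 3*ε 2)]),
   (r 111210, [(r 000001, α 6*α 9*β 4*β 7*γ 2*γ 3*γ 4*γ 5*δ 1*δ 2*ε 1),
     (r 000011, α 6*α 0*β 4*β 7*γ 2*γ 3*γ 4*γ 5*δ 1*δ 2*ε 2),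
     (r 001111, -(α 6*α 0*β 4*β 6*β 7*β 9*γ 2*γ 3*γ 5*γ 6*δ 1*δ 2*ε 2)),
     (r 011111, -(α 6*α 0*β 4*β 9*γ 2*γ 3*γ 5*γ 6*δ 1*δ 3*ε 2))]),
   (r 112210, [(r 000001, α 6*α 9*β 4*β 5*β 7*β 8*γ 2*γ 3*γ 4*γ 5*δ 1*δ 2*ε 1),
     (r 000011, α 6*α 0*β 4*β 5*β 7*β 9*γ 2*γ 3*γ 4*γ 5*δ 1*δ 2*ε 2),
     (r 000111, α 6*α 0*β 4*β 5*β 7*β 9*γ 2*γ 3*γ 5*γ 6*δ 1*δ 2*ε 2),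
     (r 010111, α 6*α 0*β 4*β 5*β 7*β 9*γ 2*γ 3*γ 5*γ 6*δ 1*δ 3*ε 2)])]

/-- The structure constants `N_{r,-s}`, where `0 ≺ r ≺ s`. -/
def table4 {V : Type*} [AddCommGroup V] (p : Fin 6 → V) (α β γ δ ε : ℕ → ℤ) :
    List (V × List (V × ℤ)) :=
  let r := ofDigits p
  [(r 100000, [(-r 101000, -α 1), (-r 101100, -α 2), (-r 111100, -α 3), (-r 101110, -α 4),
     (-r 111110, -α 5), (-r 111210, -α 6), (-r 101111, -α 7), (-r 111111, -α 8),
     (-r 111211, -α 9), (-r 111221, -α 0)]),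
   (r 001000, [(-r 101000, α 1), (-r 001100, -β 1), (-r 011100, -β 2), (-r 001110, -β 3),
     (-r 011110, -β 4), (-r 112210, -β 5), (-r 001111, -β 6), (-r 011111, -β 7),
     (-r 112211, -β 8), (-r 112221, -β 9)]),
   (r 101000, [(-r 101100, -(α 1*α 2*β 1)), (-r 111100, -(α 1*α 3*β 2)),
     (-r 101110, -(α 1*α 4*β 3)), (-r 111110, -(α 1*α 5*β 4)), (-r 112210, α 1*α 6*β 5),
     (-r 101111, -(α 1*α 7*β 6)), (-r 111111, -(α 1*α 8*β 7)), (-r 112211, α 1*α 9*β 8),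
     (-r 112221, α 1*α 0*β 9)]),
   (r 000100, [(-r 001100, β 1), (-r 101100, α 1*α 2*β 1), (-r 010100, -γ 1), (-r 000110, -γ 2),
     (-r 011210, -γ 3), (-r 111210, -(α 5*α 6*γ 3)), (-r 000111, -γ 4), (-r 011211, -γ 5),
     (-r 111211, -(α 8*α 9*γ 5)), (-r 112321, -γ 6)]),
   (r 001100, [(-r 101100, α 2), (-r 011100, -(β 1*β 2*γ 1)), (-r 001110, -(β 1*β 3*γ 2)),
     (-r 011210, β 1*β 4*γ 3), (-r 112210, -(α 5*α 6*β 1*β 5*γ 3)), (-r 001111, -(β 1*β 6*γ 4)),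
     (-r 011211, β 1*β 7*γ 5), (-r 112211, -(α 8*α 9*β 1*β 8*γ 5)), (-r 112321, β 1*β 9*γ 6)]),
   (r 101100, [(-r 111100, -(α 2*α 3*β 1*β 2*γ 1)), (-r 101110, -(α 2*α 4*β 1*β 3*γ 2)),
     (-r 111210, α 2*α 6*β 1*β 4*γ 3), (-r 112210, α 2*α 6*β 1*β 5*γ 3),
     (-r 101111, -(α 2*α 7*β 1*β 6*γ 4)), (-r 111211, α 2*α 9*β 1*β 7*γ 5),
     (-r 112211, α 2*α 9*β 1*β 8*γ 5), (-r 112321, -(α 2*α 0*β 1*β 9*γ 6))]),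
   (r 010000, [(-r 010100, γ 1), (-r 011100, β 1*β 2*γ 1), (-r 111100, α 2*α 3*β 1*β 2*γ 1),
     (-r 010110, -δ 1), (-r 011110, -(β 3*β 4*δ 1)), (-r 111110, -(α 4*α 5*β 3*β 4*δ 1)),
     (-r 010111, -δ 2), (-r 011111, -(β 6*β 7*δ 2)), (-r 111111, -(α 7*α 8*β 6*β 7*δ 2)),
     (-r 122321, -δ 3)]),
   (r 010100, [(-r 011100, β 2), (-r 111100, α 1*α 3*β 2), (-r 010110, γ 1*γ 2*δ 1),
     (-r 011210, -(β 3*β 4*γ 1*γ 3*δ 1)), (-r 111210, -(α 4*α 6*β 3*β 4*γ 1*γ 3*δ 1)),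
     (-r 010111, γ 1*γ 4*δ 2), (-r 011211, -(β 6*β 7*γ 1*γ 5*δ 2)),
     (-r 111211, -(α 7*α 9*β 6*β 7*γ 1*γ 5*δ 2)), (-r 122321, γ 1*γ 6*δ 3)]),
   (r 011100, [(-r 111100, α 3), (-r 011110, β 2*β 4*γ 1*γ 2*δ 1),
     (-r 011210, β 2*β 4*γ 1*γ 3*δ 1), (-r 112210, -(α 4*α 6*β 2*β 3*β 4*β 5*γ 1*γ 3*δ 1)),
     (-r 011111, β 2*β 7*γ 1*γ 4*δ 2), (-r 011211, β 2*β 7*γ 1*γ 5*δ 2),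
     (-r 112211, -(α 7*α 9*β 2*β 6*β 7*β 8*γ 1*γ 5*δ 2)), (-r 122321, -(β 2*β 9*γ 1*γ 6*δ 3))]),
   (r 111100, [(-r 111110, α 3*α 5*β 2*β 4*γ 1*γ 2*δ 1), (-r 111210, α 3*α 6*β 2*β 4*γ 1*γ 3*δ 1),
     (-r 112210, α 3*α 6*β 2*β 3*β 4*β 5*γ 1*γ 3*δ 1), (-r 111111, α 3*α 8*β 2*β 7*γ 1*γ 4*δ 2),
     (-r 111211, α 3*α 9*β 2*β 7*γ 1*γ 5*δ 2), (-r 112211, α 3*α 9*β 2*β 6*β 7*β 8*γ 1*γ 5*δ 2),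
     (-r 122321, α 3*α 0*β 2*β 9*γ 1*γ 6*δ 3)]),
   (r 000010, [(-r 000110, γ 2), (-r 001110, β 1*β 3*γ 2), (-r 101110, α 2*α 4*β 1*β 3*γ 2),
     (-r 010110, -(γ 1*γ 2*δ 1)), (-r 011110, -(β 2*β 4*γ 1*γ 2*δ 1)),
     (-r 111110, -(α 3*α 5*β 2*β 4*γ 1*γ 2*δ 1)), (-r 000011, -ε 1), (-r 011221, -ε 2),
     (-r 111221, -(α 9*α 0*ε 2)), (-r 112221, -(α 9*α 0*β 8*β 9*ε 2))]),
   (r 000110, [(-r 001110, β 3), (-r 101110, α 1*α 4*β 3), (-r 010110, δ 1),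
     (-r 011210, -(β 2*β 4*γ 1*γ 3*δ 1)), (-r 111210, -(α 3*α 6*β 2*β 4*γ 1*γ 3*δ 1)),
     (-r 000111, -(γ 2*γ 4*ε 1)), (-r 011221, γ 2*γ 5*ε 2), (-r 111221, α 8*α 0*γ 2*γ 5*ε 2),
     (-r 112321, -(α 9*α 0*β 8*β 9*γ 2*γ 6*ε 2))]),
   (r 001110, [(-r 101110, α 4), (-r 011110, β 3*β 4*δ 1), (-r 011210, β 3*β 4*γ 1*γ 3*δ 1),
     (-r 112210, -(α 3*α 6*β 2*β 3*β 4*β 5*γ 1*γ 3*δ 1)), (-r 001111, -(β 3*β 6*γ 2*γ 4*ε 1)),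
     (-r 011221, -(β 3*β 7*γ 2*γ 5*ε 2)), (-r 112221, α 8*α 0*β 3*β 9*γ 2*γ 5*ε 2),
     (-r 112321, α 9*α 0*β 3*β 9*γ 2*γ 6*ε 2)]),
   (r 101110, [(-r 111110, α 4*α 5*β 3*β 4*δ 1), (-r 111210, α 4*α 6*β 3*β 4*γ 1*γ 3*δ 1),
     (-r 112210, α 4*α 6*β 2*β 3*β 4*β 5*γ 1*γ 3*δ 1),
     (-r 101111, -(α 4*α 7*β 3*β 6*γ 2*γ 4*ε 1)), (-r 111221, -(α 4*α 0*β 3*β 7*γ 2*γ 5*ε 2)),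
     (-r 112221, -(α 4*α 0*β 3*β 9*γ 2*γ 5*ε 2)), (-r 112321, -(α 4*α 0*β 3*β 9*γ 2*γ 6*ε 2))]),
   (r 010110, [(-r 011110, β 4), (-r 111110, α 1*α 5*β 4), (-r 011210, -(β 1*β 4*γ 3)),
     (-r 111210, -(α 2*α 6*β 1*β 4*γ 3)), (-r 010111, -(γ 2*γ 4*δ 1*δ 2*ε 1)),
     (-r 011221, -(β 6*β 7*γ 2*γ 5*δ 1*δ 2*ε 2)),
     (-r 111221, -(α 7*α 0*β 6*β 7*γ 2*γ 5*δ 1*δ 2*ε 2)),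
     (-r 122321, -(α 9*α 0*β 8*β 9*γ 2*γ 6*δ 1*δ 3*ε 2))]),
   (r 011110, [(-r 111110, α 5), (-r 011210, γ 3), (-r 112210, -(α 2*α 6*β 1*β 5*γ 3)),
     (-r 011111, -(β 4*β 7*γ 2*γ 4*δ 1*δ 2*ε 1)), (-r 011221, β 4*β 7*γ 2*γ 5*δ 1*δ 2*ε 2),
     (-r 112221, -(α 7*α 0*β 4*β 6*β 7*β 9*γ 2*γ 5*δ 1*δ 2*ε 2)),
     (-r 122321, α 9*α 0*β 4*β 9*γ 2*γ 6*δ 1*δ 3*ε 2)]),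
   (r 111110, [(-r 111210, α 5*α 6*γ 3), (-r 112210, α 5*α 6*β 1*β 5*γ 3),
     (-r 111111, -(α 5*α 8*β 4*β 7*γ 2*γ 4*δ 1*δ 2*ε 1)),
     (-r 111221, α 5*α 0*β 4*β 7*γ 2*γ 5*δ 1*δ 2*ε 2),
     (-r 112221, α 5*α 0*β 4*β 6*β 7*β 9*γ 2*γ 5*δ 1*δ 2*ε 2),
     (-r 122321, -(α 5*α 0*β 4*β 9*γ 2*γ 6*δ 1*δ 3*ε 2))]),
   (r 011210, [(-r 111210, α 6), (-r 112210, -(α 1*α 6*β 5)),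
     (-r 011211, -(β 4*β 7*γ 2*γ 3*γ 4*γ 5*δ 1*δ 2*ε 1)),
     (-r 011221, -(β 4*β 7*γ 2*γ 3*γ 4*γ 5*δ 1*δ 2*ε 2)),
     (-r 112321, -(α 7*α 0*β 4*β 6*β 7*β 9*γ 2*γ 3*γ 5*γ 6*δ 1*δ 2*ε 2)),
     (-r 122321, -(α 8*α 0*β 4*β 9*γ 2*γ 3*γ 5*γ 6*δ 1*δ 3*ε 2))]),
   (r 111210, [(-r 112210, β 5), (-r 111211, -(α 6*α 9*β 4*β 7*γ 2*γ 3*γ 4*γ 5*δ 1*δ 2*ε 1)),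
     (-r 111221, -(α 6*α 0*β 4*β 7*γ 2*γ 3*γ 4*γ 5*δ 1*δ 2*ε 2)),
     (-r 112321, α 6*α 0*β 4*β 6*β 7*β 9*γ 2*γ 3*γ 5*γ 6*δ 1*δ 2*ε 2),
     (-r 122321, α 6*α 0*β 4*β 9*γ 2*γ 3*γ 5*γ 6*δ 1*δ 3*ε 2)]),
   (r 112210, [(-r 112211, -(α 6*α 9*β 4*β 5*β 7*β 8*γ 2*γ 3*γ 4*γ 5*δ 1*δ 2*ε 1)),
     (-r 112221, -(α 6*α 0*β 4*β 5*β 7*β 9*γ 2*γ 3*γ 4*γ 5*δ 1*δ 2*ε 2)),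
     (-r 112321, -(α 6*α 0*β 4*β 5*β 7*β 9*γ 2*γ 3*γ 5*γ 6*δ 1*δ 2*ε 2)),
     (-r 122321, -(α 6*α 0*β 4*β 5*β 7*β 9*γ 2*γ 3*γ 5*γ 6*δ 1*δ 3*ε 2))]),
   (r 000001, [(-r 000011, ε 1), (-r 000111, γ 2*γ 4*ε 1), (-r 001111, β 3*β 6*γ 2*γ 4*ε 1),
     (-r 101111, α 4*α 7*β 3*β 6*γ 2*γ 4*ε 1), (-r 010111, γ 2*γ 4*δ 1*δ 2*ε 1),
     (-r 011111, β 4*β 7*γ 2*γ 4*δ 1*δ 2*ε 1), (-r 111111, α 5*α 8*β 4*β 7*γ 2*γ 4*δ 1*δ 2*ε 1),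
     (-r 011211, β 4*β 7*γ 2*γ 3*γ 4*γ 5*δ 1*δ 2*ε 1),
     (-r 111211, α 6*α 9*β 4*β 7*γ 2*γ 3*γ 4*γ 5*δ 1*δ 2*ε 1),
     (-r 112211, α 6*α 9*β 4*β 5*β 7*β 8*γ 2*γ 3*γ 4*γ 5*δ 1*δ 2*ε 1)]),
   (r 000011, [(-r 000111, γ 4), (-r 001111, β 1*β 6*γ 4), (-r 101111, α 2*α 7*β 1*β 6*γ 4),
     (-r 010111, -(γ 1*γ 4*δ 2)), (-r 011111, -(β 2*β 7*γ 1*γ 4*δ 2)),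
     (-r 111111, -(α 3*α 8*β 2*β 7*γ 1*γ 4*δ 2)),
     (-r 011221, β 4*β 7*γ 2*γ 3*γ 4*γ 5*δ 1*δ 2*ε 2),
     (-r 111221, α 6*α 0*β 4*β 7*γ 2*γ 3*γ 4*γ 5*δ 1*δ 2*ε 2),
     (-r 112221, α 6*α 0*β 4*β 5*β 7*β 9*γ 2*γ 3*γ 4*γ 5*δ 1*δ 2*ε 2)]),
   (r 000111, [(-r 001111, β 6), (-r 101111, α 1*α 7*β 6), (-r 010111, δ 2),
     (-r 011211, -(β 2*β 7*γ 1*γ 5*δ 2)), (-r 111211, -(α 3*α 9*β 2*β 7*γ 1*γ 5*δ 2)),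
     (-r 011221, -(β 4*β 7*γ 2*γ 5*δ 1*δ 2*ε 2)),
     (-r 111221, -(α 5*α 0*β 4*β 7*γ 2*γ 5*δ 1*δ 2*ε 2)),
     (-r 112321, α 6*α 0*β 4*β 5*β 7*β 9*γ 2*γ 3*γ 5*γ 6*δ 1*δ 2*ε 2)]),
   (r 001111, [(-r 101111, α 7), (-r 011111, β 6*β 7*δ 2), (-r 011211, β 6*β 7*γ 1*γ 5*δ 2),
     (-r 112211, -(α 3*α 9*β 2*β 6*β 7*β 8*γ 1*γ 5*δ 2)),
     (-r 011221, β 6*β 7*γ 2*γ 5*δ 1*δ 2*ε 2),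
     (-r 112221, -(α 5*α 0*β 4*β 6*β 7*β 9*γ 2*γ 5*δ 1*δ 2*ε 2)),
     (-r 112321, -(α 6*α 0*β 4*β 6*β 7*β 9*γ 2*γ 3*γ 5*γ 6*δ 1*δ 2*ε 2))]),
   (r 101111, [(-r 111111, α 7*α 8*β 6*β 7*δ 2), (-r 111211, α 7*α 9*β 6*β 7*γ 1*γ 5*δ 2),
     (-r 112211, α 7*α 9*β 2*β 6*β 7*β 8*γ 1*γ 5*δ 2),
     (-r 111221, α 7*α 0*β 6*β 7*γ 2*γ 5*δ 1*δ 2*ε 2),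
     (-r 112221, α 7*α 0*β 4*β 6*β 7*β 9*γ 2*γ 5*δ 1*δ 2*ε 2),
     (-r 112321, α 7*α 0*β 4*β 6*β 7*β 9*γ 2*γ 3*γ 5*γ 6*δ 1*δ 2*ε 2)]),
   (r 010111, [(-r 011111, β 7), (-r 111111, α 1*α 8*β 7), (-r 011211, -(β 1*β 7*γ 5)),
     (-r 111211, -(α 2*α 9*β 1*β 7*γ 5)), (-r 011221, β 3*β 7*γ 2*γ 5*ε 2),
     (-r 111221, α 4*α 0*β 3*β 7*γ 2*γ 5*ε 2),
     (-r 122321, α 6*α 0*β 4*β 5*β 7*β 9*γ 2*γ 3*γ 5*γ 6*δ 1*δ 3*ε 2)]),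
   (r 011111, [(-r 111111, α 8), (-r 011211, γ 5), (-r 112211, -(α 2*α 9*β 1*β 8*γ 5)),
     (-r 011221, -(γ 2*γ 5*ε 2)), (-r 112221, α 4*α 0*β 3*β 9*γ 2*γ 5*ε 2),
     (-r 122321, -(α 6*α 0*β 4*β 9*γ 2*γ 3*γ 5*γ 6*δ 1*δ 3*ε 2))]),
   (r 111111, [(-r 111211, α 8*α 9*γ 5), (-r 112211, α 8*α 9*β 1*β 8*γ 5),
     (-r 111221, -(α 8*α 0*γ 2*γ 5*ε 2)), (-r 112221, -(α 8*α 0*β 3*β 9*γ 2*γ 5*ε 2)),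
     (-r 122321, α 8*α 0*β 4*β 9*γ 2*γ 3*γ 5*γ 6*δ 1*δ 3*ε 2)]),
   (r 011211, [(-r 111211, α 9), (-r 112211, -(α 1*α 9*β 8)), (-r 011221, ε 2),
     (-r 112321, α 4*α 0*β 3*β 9*γ 2*γ 6*ε 2), (-r 122321, α 5*α 0*β 4*β 9*γ 2*γ 6*δ 1*δ 3*ε 2)]),
   (r 111211, [(-r 112211, β 8), (-r 111221, α 9*α 0*ε 2),
     (-r 112321, -(α 9*α 0*β 3*β 9*γ 2*γ 6*ε 2)),
     (-r 122321, -(α 9*α 0*β 4*β 9*γ 2*γ 6*δ 1*δ 3*ε 2))]),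
   (r 112211, [(-r 112221, α 9*α 0*β 8*β 9*ε 2), (-r 112321, α 9*α 0*β 8*β 9*γ 2*γ 6*ε 2),
     (-r 122321, α 9*α 0*β 8*β 9*γ 2*γ 6*δ 1*δ 3*ε 2)]),
   (r 011221, [(-r 111221, α 0), (-r 112221, -(α 1*α 0*β 9)), (-r 112321, α 2*α 0*β 1*β 9*γ 6),
     (-r 122321, -(α 3*α 0*β 2*β 9*γ 1*γ 6*δ 3))]),
   (r 111221, [(-r 112221, β 9), (-r 112321, -(β 1*β 9*γ 6)), (-r 122321, β 2*β 9*γ 1*γ 6*δ 3)]),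
   (r 112221, [(-r 112321, γ 6), (-r 122321, -(γ 1*γ 6*δ 3))]),
   (r 112321, [(-r 122321, δ 3)])]

end E6

end

/-! In a simply laced root system every non-zero structure constant is a sign, so all of them are
determined by their values on the extraspecial pairs through three rules. The first is antisymmetry
(`N_swap`). The second is the Jacobi identity (`N_jacobi`). The third is `N_neg_add_right`, the
relation N(x, -(x+y)) = -N(x, y), which reduces a pair of a positive and a negative root to a pair
of positive roots.

Let (n, m) be a pair of positive roots whose sum is a root, let (r, s) be the extraspecial pair with
the same sum, and suppose {n, m} ≠ {r, s}. Here r is a simple root. Since n + m = r + s has Cartan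
integer 1 with r, one of n, m has Cartan integer 1 with r and the other has 0. If m is the former,
then x = m - r is a positive root and r + n is not a root. One term of the Jacobi identity for r, x,
n therefore vanishes, leaving N(n, m) = -N(r, s) N(x, n) N(r, x). The last two factors belong to
sums s and m of smaller height, so the recursion `structureMask` ends at the extraspecial values.

The rest makes this a finite computation. Positive roots are coded by their six-digit numbers, and
reflections show that the roots are exactly the 36 coded vectors and their negatives
(`mem_range_root_iff`). A signed monomial in parameters equal to ±1 is a vector of exponents modulo
2, stored as the bits of a natural number, with multiplication becoming exclusive or
(`evalMask_xor`). The kernel compares the recursion with every entry of Tables 3 and 4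
(`special_spec`, `difference_spec`) and checks that the tables are exhaustive (`extraspecial_iff`,
`exists_special`, `exists_difference`). -/

noncomputable section

namespace E6

namespace ChevalleyBasis

/-! ### Antisymmetry and the Jacobi identity for the structure constants. -/

section Lie

variable {L : Type*} [LieRing L] [LieAlgebra ℂ L] [FiniteDimensional ℂ L] [IsKilling ℂ L]
  {H : LieSubalgebra ℂ L} [H.IsCartanSubalgebra] (C : ChevalleyBasis H)

theorem lie_eq_zero (r s : H.root)
    (h : (rootSystem H).root r + (rootSystem H).root s ∉ Set.range (rootSystem H).root)
    (h0 : (rootSystem H).root r + (rootSystem H).root s ≠ 0) : ⁅C.e r, C.e s⁆ = 0 := by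
  by_contra hne
  have hmem : ⁅C.e r, C.e s⁆ ∈ rootSpace H
      (((rootSystem H).root r + (rootSystem H).root s : Dual ℂ H) : H → ℂ) :=
    lie_mem_genWeightSpace_of_mem_genWeightSpace (C.e_mem r) (C.e_mem s)
  have hbot : rootSpace H
      (((rootSystem H).root r + (rootSystem H).root s : Dual ℂ H) : H → ℂ) ≠ ⊥ := by
    intro hb
    rw [hb] at hmem
    exact hne (by simpa using hmem)
  let χ : LieModule.Weight ℂ H L := ⟨_, hbot⟩
  have hχ : χ.IsNonZero := fun hz => h0 (by ext x; exact congrFun hz x)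
  exact h ⟨⟨χ, by simpa using hχ⟩, by ext x; rfl⟩

/-- Its bracket with the opposite root vector is a coroot, which is non-zero. -/
theorem e_ne_zero (r : H.root) : C.e r ≠ 0 := by
  intro h
  have h1 := C.lie_of_add_eq_zero r ((rootSystem H).reflectionPerm r r) (by
    rw [RootPairing.root_reflectionPerm, RootPairing.reflection_apply_self, add_neg_cancel])
  rw [h, zero_lie] at h1
  have h2 : (rootSystem H).coroot r = 0 := by ext; exact h1.symm
  exact (rootSystem H).flip.ne_zero r h2

theorem lie_lie_e (r t : H.root) : ⁅((rootSystem H).coroot r : L), C.e t⁆ =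
    (rootSystem H).pairing t r • C.e t :=
  lie_eq_smul_of_mem_rootSpace (C.e_mem t) ((rootSystem H).coroot r)

/-- The root vector of a root, and `0` for the linear forms that are not roots. -/
def vec (x : Dual ℂ H) : L := by
  classical exact if h : ∃ i, (rootSystem H).root i = x then C.e h.choose else 0

theorem vec_root (i : H.root) : C.vec ((rootSystem H).root i) = C.e i := by
  have h : ∃ j, (rootSystem H).root j = (rootSystem H).root i := ⟨i, rfl⟩
  rw [vec, dif_pos h, (rootSystem H).root.injective h.choose_spec]

theorem vec_eq_zero {x : Dual ℂ H} (h : x ∉ Set.range (rootSystem H).root) : C.vec x = 0 :=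
  dif_neg h

/-- Extending the root vectors by zero makes one formula cover roots and non-roots alike. Only x + y
= 0 has to be excluded, where the bracket may be a coroot. -/
theorem lie_vec {x y : Dual ℂ H} (h : x + y ≠ 0) :
    ⁅C.vec x, C.vec y⁆ = C.N x y • C.vec (x + y) := by
  by_cases hx : x ∈ Set.range (rootSystem H).root
  swap
  · rw [C.vec_eq_zero hx, C.N_eq_zero x y (by tauto)]; simp
  by_cases hy : y ∈ Set.range (rootSystem H).root
  swap
  · rw [C.vec_eq_zero hy, C.N_eq_zero x y (by tauto)]; simp
  obtain ⟨r, rfl⟩ := hx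
  obtain ⟨s, rfl⟩ := hy
  by_cases hxy : (rootSystem H).root r + (rootSystem H).root s ∈ Set.range (rootSystem H).root
  · obtain ⟨t, ht⟩ := hxy
    rw [← ht, C.vec_root, C.vec_root, C.vec_root, C.lie_of_add_eq_root r s t ht.symm]
  · rw [C.vec_root, C.vec_root, C.lie_eq_zero r s hxy h, C.N_eq_zero _ _ (by tauto), zero_smul]

theorem vec_ne_zero {x : Dual ℂ H} (hx : x ∈ Set.range (rootSystem H).root) : C.vec x ≠ 0 := by
  obtain ⟨r, rfl⟩ := hx
  rw [C.vec_root]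
  exact C.e_ne_zero r

theorem eq_zero_of_smul_vec {x : Dual ℂ H} (hx : x ∈ Set.range (rootSystem H).root) {n : ℤ}
    (h : n • C.vec x = 0) : n = 0 := by
  rw [← Int.cast_smul_eq_zsmul ℂ, smul_eq_zero] at h
  exact_mod_cast h.resolve_right (C.vec_ne_zero hx)

theorem ne_zero_of_mem_root {x : Dual ℂ H} (hx : x ∈ Set.range (rootSystem H).root) : x ≠ 0 := by
  obtain ⟨r, rfl⟩ := hx
  exact (rootSystem H).ne_zero r

theorem N_swap (x y : Dual ℂ H) : C.N y x = -C.N x y := by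
  by_cases h : x ∈ Set.range (rootSystem H).root ∧ y ∈ Set.range (rootSystem H).root ∧
      x + y ∈ Set.range (rootSystem H).root
  · have h0 := ne_zero_of_mem_root h.2.2
    have h1 := C.lie_vec h0
    have h2 := C.lie_vec (x := y) (y := x) (by rwa [add_comm])
    rw [← lie_skew, h1, add_comm y x] at h2
    have := C.eq_zero_of_smul_vec h.2.2 (n := C.N y x + C.N x y) (by
      rw [add_smul, ← h2]; simp)
    linarith
  · rw [C.N_eq_zero x y h, C.N_eq_zero y x (by rw [add_comm y x]; tauto), neg_zero]

/-- This is the coefficient of the root vector of x + y + z in the Jacobi identity. A pair whose sum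
is not a root contributes zero, so no case distinction is needed. -/
theorem N_jacobi {x y z : Dual ℂ H} (hxy : x + y ≠ 0) (hyz : y + z ≠ 0) (hzx : z + x ≠ 0)
    (h : x + y + z ∈ Set.range (rootSystem H).root) :
    C.N y z * C.N x (y + z) + C.N z x * C.N y (z + x) + C.N x y * C.N z (x + y) = 0 := by
  have h0 := ne_zero_of_mem_root h
  have e1 : x + (y + z) = x + y + z := by abel
  have e2 : y + (z + x) = x + y + z := by abel
  have e3 : z + (x + y) = x + y + z := by abel
  have j := lie_jacobi (C.vec x) (C.vec y) (C.vec z)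
  rw [C.lie_vec hyz, C.lie_vec hzx, C.lie_vec hxy, lie_zsmul, lie_zsmul, lie_zsmul,
    C.lie_vec (e1 ▸ h0), C.lie_vec (e2 ▸ h0), C.lie_vec (e3 ▸ h0), e1, e2, e3] at j
  refine C.eq_zero_of_smul_vec h ?_
  rw [add_smul, add_smul, mul_smul, mul_smul, mul_smul, j]

end Lie

/-! ### Signs of the structure constants in the simply laced case. -/

section SimplyLaced

variable {L : Type*} [LieRing L] [LieAlgebra ℂ L] [FiniteDimensional ℂ L] [IsKilling ℂ L]
  {H : LieSubalgebra ℂ L} [H.IsCartanSubalgebra] (C : ChevalleyBasis H)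
  (hΦ : ∀ x ∈ Set.range (rootSystem H).root, ∀ y ∈ Set.range (rootSystem H).root,
    x + y ∈ Set.range (rootSystem H).root → y - x ∉ Set.range (rootSystem H).root)

include hΦ in
theorem chainBotCoeff_eq_zero {r s : H.root}
    (h : (rootSystem H).root r + (rootSystem H).root s ∈ Set.range (rootSystem H).root) :
    (rootSystem H).chainBotCoeff r s = 0 :=
  RootPairing.chainBotCoeff_eq_zero_iff.2 (Or.inr (hΦ _ ⟨r, rfl⟩ _ ⟨s, rfl⟩ h))

include hΦ in
theorem N_eq_one_or {x y : Dual ℂ H} (hx : x ∈ Set.range (rootSystem H).root)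
    (hy : y ∈ Set.range (rootSystem H).root) (hxy : x + y ∈ Set.range (rootSystem H).root) :
    C.N x y = 1 ∨ C.N x y = -1 := by
  obtain ⟨r, rfl⟩ := hx
  obtain ⟨s, rfl⟩ := hy
  have h0 := chainBotCoeff_eq_zero hΦ hxy
  obtain ⟨t, ht⟩ := hxy
  simpa [h0] using C.N_eq_or r s t ht.symm

theorem neg_mem_range_root {x : Dual ℂ H} (hx : x ∈ Set.range (rootSystem H).root) :
    -x ∈ Set.range (rootSystem H).root :=
  (rootSystem H).neg_mem_range_root_iff.2 hx

include hΦ in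
-- Bracketing [e_x, e_y] with e_{-x} gives N(x, y) N(-x, x+y) = -⟨y, x^∨⟩, because y - x is not a
-- root. The right side is non-negative and both factors are signs, so they agree.
theorem N_neg_add {x y : Dual ℂ H} (hx : x ∈ Set.range (rootSystem H).root)
    (hy : y ∈ Set.range (rootSystem H).root) (hxy : x + y ∈ Set.range (rootSystem H).root) :
    C.N (-x) (x + y) = C.N x y := by
  have h1 := C.N_eq_one_or hΦ hx hy hxy
  have h2 := C.N_eq_one_or hΦ (neg_mem_range_root hx) hxy (by simpa using hy)
  have hd := hΦ x hx y hy hxy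
  obtain ⟨r, rfl⟩ := hx
  obtain ⟨t, rfl⟩ := hy
  have hr : (rootSystem H).root ((rootSystem H).reflectionPerm r r) = -(rootSystem H).root r := by
    rw [RootPairing.root_reflectionPerm, RootPairing.reflection_apply_self]
  have hbot := chainBotCoeff_eq_zero hΦ hxy
  have hli := (rootSystem H).linearIndependent_of_add_mem_range_root' hxy
  -- The Cartan integer is the bottom chain length minus the top one, and the bottom one is zero.
  have hpair : (rootSystem H).pairingIn ℤ t r ≤ 0 := by
    have := (rootSystem H).chainBotCoeff_sub_chainTopCoeff hli
    omega
  have hsub : ⁅C.vec (-(rootSystem H).root r), C.vec ((rootSystem H).root t)⁆ = 0 := by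
    have e : -(rootSystem H).root r + (rootSystem H).root t =
      (rootSystem H).root t - (rootSystem H).root r := by abel
    rw [C.lie_vec, e, C.vec_eq_zero hd, smul_zero]
    intro h0
    have h3 : (rootSystem H).root t = (rootSystem H).root r := by rwa [e, sub_eq_zero] at h0
    rw [h3] at hli
    exact zero_ne_one (hli.injective (a₁ := 0) (a₂ := 1) rfl)
  have hj := leibniz_lie (C.vec (-(rootSystem H).root r)) (C.vec ((rootSystem H).root r))
    (C.vec ((rootSystem H).root t))
  have hcor : ⁅C.vec (-(rootSystem H).root r), C.vec ((rootSystem H).root r)⁆ =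
      -((rootSystem H).coroot r : L) := by
    rw [← lie_skew, ← hr, C.vec_root, C.vec_root, C.lie_of_add_eq_zero r _ (by rw [hr, add_neg_cancel])]
  rw [hsub, lie_zero, add_zero, hcor, neg_lie, C.vec_root t, C.lie_lie_e, ← C.vec_root t,
    C.lie_vec (ne_zero_of_mem_root hxy), lie_zsmul,
    C.lie_vec (by simp), neg_add_cancel_left, smul_smul,
    ← (rootSystem H).algebraMap_pairingIn ℤ, algebraMap_smul, ← neg_smul, ← sub_eq_zero,
    ← sub_smul] at hj
  have := C.eq_zero_of_smul_vec ⟨t, rfl⟩ hj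
  -- Opposite signs would make the product -1, contradicting `hpair`.
  rcases h1 with h1 | h1 <;> rcases h2 with h2 | h2 <;> rw [h1, h2] at this ⊢ <;> omega

include hΦ in
-- Alternating `N_neg_add` with antisymmetry gives N(x, -(x+y)) = N(-x, -y) = -N(y, -(x+y)) = N(x+y,
-- -x) = -N(x, y).
theorem N_neg_add_right {x y : Dual ℂ H} (hx : x ∈ Set.range (rootSystem H).root)
    (hy : y ∈ Set.range (rootSystem H).root) (hxy : x + y ∈ Set.range (rootSystem H).root) :
    C.N x (-(x + y)) = -C.N x y := by
  have nx := neg_mem_range_root hx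
  have ny := neg_mem_range_root hy
  have nxy := neg_mem_range_root hxy
  have h1 := C.N_neg_add hΦ hx hy hxy
  have h2 := C.N_neg_add hΦ hxy nx (by simpa using hy)
  have h3 := C.N_neg_add hΦ hy nxy (by convert nx using 1; abel)
  have h4 := C.N_neg_add hΦ nx ny (by convert nxy using 1; abel)
  rw [show x + y + -x = y by abel] at h2
  rw [show y + -(x + y) = -x by abel] at h3
  rw [neg_neg, show -x + -y = -(x + y) by abel] at h4
  have s1 := C.N_swap (-x) (x + y)
  have s2 := C.N_swap (-(x + y)) y
  have s3 := C.N_swap (-x) (-y)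
  linarith

end SimplyLaced

end ChevalleyBasis

/-! ### The positive roots as decimal codes, with the finite checks on them. -/

/-- The positive roots of `E₆` in the six-digit notation, in the order `≺`. -/
def positiveCodes : List ℕ :=
  [100000, 001000, 101000, 000100, 001100, 101100, 010000, 010100, 011100,
    111100, 000010, 000110, 001110, 101110, 010110, 011110, 111110, 011210,
    111210, 112210, 000001, 000011, 000111, 001111, 101111, 010111, 011111,
    111111, 011211, 111211, 112211, 011221, 111221, 112221, 112321, 122321]

/-- The coefficients of the simple roots in the six-digit notation. -/
def digits (n : ℕ) : Fin 6 → ℕ :=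
  ![n / 100000 % 10, n / 10000 % 10, n / 1000 % 10, n / 100 % 10, n / 10 % 10, n % 10]

/-- The simple roots in the six-digit notation. -/
def simpleCode : Fin 6 → ℕ := ![100000, 010000, 001000, 000100, 000010, 000001]

/-- The Cartan integer of a root, in the six-digit notation, with the `j`-th simple root. -/
def pairingSimple (n : ℕ) (j : Fin 6) : ℤ := ∑ i, (digits n i : ℤ) * CartanMatrix.E₆ i j

/-- The order `≺` in the six-digit notation. -/
def Precedes (n m : ℕ) : Prop :=
  ∃ k : Fin 6, (∀ j < k, digits n (![5, 4, 1, 3, 2, 0] j) = digits m (![5, 4, 1, 3, 2, 0] j)) ∧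
    digits n (![5, 4, 1, 3, 2, 0] k) < digits m (![5, 4, 1, 3, 2, 0] k)

instance : DecidableRel Precedes := fun _ _ => by unfold Precedes; infer_instance

/-- No digit exceeds 3, so adding two codes never produces a carry and addition of codes is addition
of roots. -/
theorem digits_add_of_mem : ∀ n ∈ positiveCodes, ∀ m ∈ positiveCodes,
    ∀ i, digits (n + m) i = digits n i + digits m i := by decide +kernel

theorem lt_of_mem : ∀ n ∈ positiveCodes, 0 < n ∧ n < 500000 := by decide +kernel

theorem precedes_zero : ∀ n ∈ positiveCodes, Precedes 0 n := by decide +kernel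

theorem simpleCode_mem : ∀ j, simpleCode j ∈ positiveCodes := by decide +kernel

theorem digits_simpleCode : ∀ j i, digits (simpleCode j) i = if i = j then 1 else 0 := by
  decide +kernel

/-- A simple reflection permutes the positive roots other than its own simple root. This closes the
induction showing that every root is coded up to sign. -/
theorem reflect_mem : ∀ n ∈ positiveCodes, ∀ j, n = simpleCode j ∨
    ∃ m ∈ positiveCodes, ∀ i, (digits m i : ℤ) =
      digits n i - pairingSimple n j * (if i = j then 1 else 0) := by decide +kernel

/-- Each non-simple code arises by a simple reflection from a numerically smaller one. This drives
the strong induction showing that every code is a root. -/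
theorem exists_reflect : ∀ n ∈ positiveCodes, (∃ j, n = simpleCode j) ∨
    ∃ m ∈ positiveCodes, m < n ∧ ∃ j, ∀ i, (digits n i : ℤ) =
      digits m i - pairingSimple m j * (if i = j then 1 else 0) := by decide +kernel

/-- The simply laced property for positive roots: a sum and a difference of the same two roots are
never both roots. -/
theorem add_ne_of_add_mem : ∀ n ∈ positiveCodes, ∀ m ∈ positiveCodes, n + m ∈ positiveCodes →
    ∀ k ∈ positiveCodes, n + k ≠ m := by decide +kernel

/-! ### Codes as linear combinations of the simple roots, and the order on them. -/

section Digits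

variable {V : Type*} [AddCommGroup V] (p : Fin 6 → V)

theorem ofDigits_eq_sum (n : ℕ) : ofDigits p n = ∑ i, digits n i • p i := by
  simp [ofDigits, digits, Fin.sum_univ_six]

theorem ofDigits_add {n m : ℕ} (hn : n ∈ positiveCodes) (hm : m ∈ positiveCodes) :
    ofDigits p (n + m) = ofDigits p n + ofDigits p m := by
  simp [ofDigits_eq_sum, digits_add_of_mem n hn m hm, add_smul, Finset.sum_add_distrib]

theorem ofDigits_simpleCode (j : Fin 6) : ofDigits p (simpleCode j) = p j := by
  simp [ofDigits_eq_sum, digits_simpleCode]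

theorem ofDigits_zero : ofDigits p 0 = 0 := by simp [ofDigits]

theorem eq_of_digits_eq {n m : ℕ} (hn : n < 1000000) (hm : m < 1000000)
    (h : digits n = digits m) : n = m := by
  have h0 := congrFun h 0
  have h1 := congrFun h 1
  have h2 := congrFun h 2
  have h3 := congrFun h 3
  have h4 := congrFun h 4
  have h5 := congrFun h 5
  simp [digits] at h0 h1 h2 h3 h4 h5
  omega

theorem ofDigits_eq_of_digits {n m : ℕ} {k : ℤ} {j : Fin 6}
    (h : ∀ i, (digits m i : ℤ) = digits n i - k * (if i = j then 1 else 0)) :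
    ofDigits p m = ofDigits p n - k • p j := by
  have h1 : ∀ n, ofDigits p n = ∑ i, (digits n i : ℤ) • p i := fun n => by
    simp only [ofDigits_eq_sum, natCast_zsmul]
  simp [h1, h, sub_smul, Finset.sum_sub_distrib]

theorem digits_zero : ∀ i, digits 0 i = 0 := by decide

end Digits

section Independent

variable {V : Type*} [AddCommGroup V] [Module ℂ V] {p : Fin 6 → V}

theorem sum_eq_iff (hp : LinearIndependent ℂ p) {a b : Fin 6 → ℂ}
    (h : ∑ i, a i • p i = ∑ i, b i • p i) : a = b := by
  ext i
  rw [← sub_eq_zero, ← Finset.sum_sub_distrib] at h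
  simp only [← sub_smul] at h
  exact sub_eq_zero.1 (Fintype.linearIndependent_iff.1 hp _ h i)

theorem ofDigits_eq_sum_complex (p : Fin 6 → V) (n : ℕ) :
    ofDigits p n = ∑ i, (digits n i : ℂ) • p i := by
  simp only [ofDigits_eq_sum, Nat.cast_smul_eq_nsmul]

theorem ofDigits_injective (hp : LinearIndependent ℂ p) {n m : ℕ} (hn : n < 1000000)
    (hm : m < 1000000) (h : ofDigits p n = ofDigits p m) : n = m := by
  rw [ofDigits_eq_sum_complex, ofDigits_eq_sum_complex] at h
  refine eq_of_digits_eq hn hm (funext fun i => ?_)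
  exact_mod_cast congrFun (sum_eq_iff hp h) i

/-- The order in which `≺` compares the coefficients. -/
def precOrder : Fin 6 ≃ Fin 6 where
  toFun := ![5, 4, 1, 3, 2, 0]
  invFun := ![5, 2, 4, 3, 1, 0]
  left_inv := by decide
  right_inv := by decide

theorem sum_precOrder (p : Fin 6 → V) (a : Fin 6 → ℂ) :
    ∑ i, a i • (![p 5, p 4, p 1, p 3, p 2, p 0] : Fin 6 → V) i =
      ∑ i, a (precOrder.symm i) • p i := by
  simp [Fin.sum_univ_six, precOrder]
  abel

/-- By linear independence the real coefficients in `Prec` are the given ones, up to the permutation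
`precOrder`. -/
theorem prec_sum_iff (hp : LinearIndependent ℂ p) (x y : Fin 6 → ℝ) :
    Prec p (∑ i, (x i : ℂ) • p i) (∑ i, (y i : ℂ) • p i) ↔
      ∃ k, (∀ j < k, x (precOrder j) = y (precOrder j)) ∧ x (precOrder k) < y (precOrder k) := by
  constructor
  · rintro ⟨τ, ρ, h1, h2, h⟩
    rw [sum_precOrder p fun i => (τ i : ℂ)] at h1
    rw [sum_precOrder p fun i => (ρ i : ℂ)] at h2
    have e1 : ∀ i, x (precOrder i) = τ i := fun i => by
      simpa using congrFun (sum_eq_iff hp h1) (precOrder i)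
    have e2 : ∀ i, y (precOrder i) = ρ i := fun i => by
      simpa using congrFun (sum_eq_iff hp h2) (precOrder i)
    simpa only [e1, e2] using h
  · intro h
    refine ⟨x ∘ precOrder, y ∘ precOrder, ?_, ?_, h⟩
    · rw [sum_precOrder p fun i => ((x ∘ precOrder) i : ℂ)]
      simp
    · rw [sum_precOrder p fun i => ((y ∘ precOrder) i : ℂ)]
      simp

theorem prec_ofDigits_iff (hp : LinearIndependent ℂ p) (n m : ℕ) :
    Prec p (ofDigits p n) (ofDigits p m) ↔ Precedes n m := by
  have h := prec_sum_iff hp (fun i => digits n i) (fun i => digits m i)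
  simp only [Complex.ofReal_natCast, ← ofDigits_eq_sum_complex] at h
  rw [h]
  simp only [Nat.cast_inj, Nat.cast_lt]
  rfl

/-- All coefficients on the left are non-negative and all on the right non-positive, so no
coefficient increases. Hence a root that follows a coded vector is itself positive. -/
theorem not_prec_neg_ofDigits (hp : LinearIndependent ℂ p) (n m : ℕ) :
    ¬ Prec p (ofDigits p n) (-ofDigits p m) := by
  have h := prec_sum_iff hp (fun i => digits n i) (fun i => -(digits m i : ℝ))
  simp only [Complex.ofReal_neg, Complex.ofReal_natCast, neg_smul, Finset.sum_neg_distrib,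
    ← ofDigits_eq_sum_complex] at h
  rw [h]
  rintro ⟨k, -, hk⟩
  have := (digits n (precOrder k)).cast_nonneg (α := ℝ)
  have := (digits m (precOrder k)).cast_nonneg (α := ℝ)
  linarith

end Independent

/-! ### The roots are the coded vectors and their negatives. -/

section RootSystem

variable {L : Type*} [LieRing L] [LieAlgebra ℂ L] [FiniteDimensional ℂ L] [IsKilling ℂ L]
  {H : LieSubalgebra ℂ L} [H.IsCartanSubalgebra]
  {B : (rootSystem H).Base} {σ : Fin 6 ≃ B.support}
  (hσ : ∀ i j, B.cartanMatrix (σ i) (σ j) = CartanMatrix.E₆ i j)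
  {p : Fin 6 → Dual ℂ H} (hp : ∀ i, p i = (rootSystem H).root (σ i))

include hp in
theorem linearIndependent_simple : LinearIndependent ℂ p := by
  have h : LinearIndependent ℂ (fun i : B.support => (rootSystem H).root i) :=
    B.linearIndepOn_root
  have := h.comp σ σ.injective
  rwa [show p = (fun i : B.support => (rootSystem H).root i) ∘ σ from funext hp]

include hσ hp in
theorem reflection_simple (j : Fin 6) (n : ℕ) :
    (rootSystem H).reflection (σ j) (ofDigits p n) = ofDigits p n - pairingSimple n j • p j := by
  have h1 : ∀ i, (rootSystem H).reflection (σ j) (p i) = p i - CartanMatrix.E₆ i j • p j := by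
    intro i
    rw [hp i, hp j, RootPairing.reflection_apply_root' ℤ, ← hσ i j]
    rfl
  simp only [ofDigits_eq_sum, pairingSimple, map_sum, map_nsmul, h1, smul_sub,
    Finset.sum_sub_distrib, Finset.sum_smul, mul_smul, natCast_zsmul]

include hσ hp in
theorem ofDigits_mem_range_root {n : ℕ} (hn : n ∈ positiveCodes) :
    ofDigits p n ∈ Set.range (rootSystem H).root := by
  induction n using Nat.strong_induction_on with
  | _ n ih =>
    rcases exists_reflect n hn with ⟨j, rfl⟩ | ⟨m, hm, hlt, j, h⟩
    · exact ⟨σ j, by rw [ofDigits_simpleCode, hp]⟩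
    · obtain ⟨i, hi⟩ := ih m hlt hm
      exact ⟨(rootSystem H).reflectionPerm (σ j) i, by
        rw [RootPairing.root_reflectionPerm, hi, reflection_simple hσ hp,
          ofDigits_eq_of_digits p h]⟩

include hσ hp in
theorem exists_root_eq_ofDigits (i : H.root) : ∃ n ∈ positiveCodes,
    (rootSystem H).root i = ofDigits p n ∨ (rootSystem H).root i = -ofDigits p n := by
  induction i using B.induction_reflect with
  | h₀ i ih =>
    obtain ⟨n, hn, h⟩ := ih
    refine ⟨n, hn, ?_⟩
    rw [RootPairing.root_reflectionPerm, RootPairing.reflection_apply_self]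
    rcases h with h | h <;> simp [h]
  | h₁ i hi =>
    refine ⟨_, simpleCode_mem (σ.symm ⟨i, hi⟩), Or.inl ?_⟩
    rw [ofDigits_simpleCode, hp, Equiv.apply_symm_apply]
  | h₂ i j ih hj =>
    obtain ⟨k, hk⟩ : ∃ k, (σ k : H.root) = j := ⟨σ.symm ⟨j, hj⟩, by simp⟩
    obtain ⟨n, hn, h⟩ := ih
    rw [RootPairing.root_reflectionPerm, ← hk]
    rcases reflect_mem n hn k with rfl | ⟨m, hm, hnm⟩
    -- The reflection only changes the sign of its own simple root.
    · refine ⟨_, simpleCode_mem k, ?_⟩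
      rw [ofDigits_simpleCode, hp k] at *
      rcases h with h | h <;> simp [h, RootPairing.reflection_apply_self, -rootSystem_root_apply]
    · refine ⟨m, hm, ?_⟩
      rw [ofDigits_eq_of_digits p hnm, ← reflection_simple hσ hp]
      rcases h with h | h <;> rw [h] <;> simp

include hσ hp in
theorem mem_range_root_iff {x : Dual ℂ H} : x ∈ Set.range (rootSystem H).root ↔
    ∃ n ∈ positiveCodes, x = ofDigits p n ∨ x = -ofDigits p n := by
  constructor
  · rintro ⟨i, rfl⟩
    exact exists_root_eq_ofDigits hσ hp i
  · rintro ⟨n, hn, rfl | rfl⟩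
    · exact ofDigits_mem_range_root hσ hp hn
    · exact ChevalleyBasis.neg_mem_range_root (ofDigits_mem_range_root hσ hp hn)

include hp in
theorem ofDigits_inj_of_lt {n m : ℕ} (hn : n < 1000000) (hm : m < 1000000) :
    ofDigits p n = ofDigits p m ↔ n = m :=
  ⟨ofDigits_injective (linearIndependent_simple hp) hn hm, fun h => h ▸ rfl⟩

include hσ hp in
theorem ofDigits_add_mem_iff {n m : ℕ} (hn : n ∈ positiveCodes) (hm : m ∈ positiveCodes) :
    ofDigits p n + ofDigits p m ∈ Set.range (rootSystem H).root ↔ n + m ∈ positiveCodes := by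
  have ln := lt_of_mem n hn
  have lm := lt_of_mem m hm
  rw [mem_range_root_iff hσ hp, ← ofDigits_add p hn hm]
  constructor
  · rintro ⟨k, hk, h | h⟩
    · have lk := lt_of_mem k hk
      rw [ofDigits_inj_of_lt hp (by omega) (by omega)] at h
      rwa [h]
    -- If the sum were the negative of a coded root, a sum of non-negative coefficients would
    -- vanish, so that root would have code 0.
    · exfalso
      rw [eq_neg_iff_add_eq_zero, ofDigits_eq_sum, ofDigits_eq_sum, ← Finset.sum_add_distrib] at h
      have h0 := sum_eq_iff (linearIndependent_simple hp)
        (a := fun i => ((digits (n + m) i + digits k i : ℕ) : ℂ)) (b := 0)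
        (by simpa [add_smul, Nat.cast_smul_eq_nsmul] using h)
      have h1 : ∀ i, digits k i = digits 0 i := fun i => by
        have h1 := congrFun h0 i
        simp only [Pi.zero_apply, Nat.cast_eq_zero] at h1
        rw [digits_zero]
        omega
      have lk := lt_of_mem k hk
      have := eq_of_digits_eq (by omega) (by omega) (funext h1)
      omega
  · exact fun h => ⟨_, h, Or.inl rfl⟩

include hσ hp in
theorem ofDigits_sub_mem_iff {n m : ℕ} (hn : n ∈ positiveCodes) (hm : m ∈ positiveCodes) :
    ofDigits p m - ofDigits p n ∈ Set.range (rootSystem H).root ↔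
      ∃ k ∈ positiveCodes, n + k = m ∨ m + k = n := by
  have ln := lt_of_mem n hn
  have lm := lt_of_mem m hm
  rw [mem_range_root_iff hσ hp]
  refine exists_congr fun k => and_congr_right fun hk => ?_
  have lk := lt_of_mem k hk
  refine or_congr ?_ ?_
  · rw [sub_eq_iff_eq_add', ← ofDigits_add p hn hk, ofDigits_inj_of_lt hp (by omega) (by omega),
      eq_comm]
  · rw [sub_eq_iff_eq_add, neg_add_eq_sub, eq_sub_iff_add_eq, ← ofDigits_add p hm hk,
      ofDigits_inj_of_lt hp (by omega) (by omega)]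

include hσ hp in
-- This supplies the simply laced hypothesis under which the sign relations were derived.
theorem sub_notMem_of_add_mem : ∀ x ∈ Set.range (rootSystem H).root,
    ∀ y ∈ Set.range (rootSystem H).root, x + y ∈ Set.range (rootSystem H).root →
      y - x ∉ Set.range (rootSystem H).root := by
  have key : ∀ n ∈ positiveCodes, ∀ m ∈ positiveCodes,
      ofDigits p n + ofDigits p m ∈ Set.range (rootSystem H).root →
      ofDigits p m - ofDigits p n ∉ Set.range (rootSystem H).root := by
    intro n hn m hm h h'
    rw [ofDigits_add_mem_iff hσ hp hn hm] at h
    obtain ⟨k, hk, h' | h'⟩ := (ofDigits_sub_mem_iff hσ hp hn hm).1 h'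
    · exact add_ne_of_add_mem n hn m hm h k hk h'
    · exact add_ne_of_add_mem m hm n hn (by rwa [add_comm]) k hk h'
  have neg_iff : ∀ x, -x ∈ Set.range (rootSystem H).root ↔ x ∈ Set.range (rootSystem H).root :=
    fun x => (rootSystem H).neg_mem_range_root_iff
  intro x hx y hy h h'
  obtain ⟨n, hn, rfl | rfl⟩ := (mem_range_root_iff hσ hp).1 hx <;>
  obtain ⟨m, hm, rfl | rfl⟩ := (mem_range_root_iff hσ hp).1 hy
  · exact key n hn m hm h h'
  -- For roots of opposite sign, the sum and the difference exchange roles up to sign.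
  · refine key n hn m hm ?_ ?_
    · rw [← neg_iff]; convert h' using 1; abel
    · rw [← neg_iff]; convert h using 1; abel
  · refine key n hn m hm ?_ ?_
    · convert h' using 1; abel
    · convert h using 1; abel
  · refine key n hn m hm ?_ ?_
    · rw [← neg_iff]; convert h using 1; abel
    · rw [← neg_iff]; convert h' using 1; abel

include hσ hp in
theorem eq_ofDigits_of_prec {x : Dual ℂ H} {n : ℕ} (hx : x ∈ Set.range (rootSystem H).root)
    (h : Prec p (ofDigits p n) x) : ∃ m ∈ positiveCodes, x = ofDigits p m := by
  obtain ⟨m, hm, rfl | rfl⟩ := (mem_range_root_iff hσ hp).1 hx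
  · exact ⟨m, hm, rfl⟩
  · exact absurd h (not_prec_neg_ofDigits (linearIndependent_simple hp) n m)

end RootSystem

/-! ### The three tables in numerical form. -/

/-- The extraspecial pairs `(r, s)` by rows `(r, [(s, c), …])`, where `c` is the code of the
parameter naming `N_{r,s}`: the codes of `α i, β i, γ i, δ i, ε i` are
`i, 10 + i, 20 + i, 30 + i, 40 + i`. -/
def extraspecialCodes : List (ℕ × List (ℕ × ℕ)) :=
  [(100000, [(001000, 1), (001100, 2), (011100, 3), (001110, 4), (011110, 5), (011210, 6),
     (001111, 7), (011111, 8), (011211, 9), (011221, 0)]),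
   (001000, [(000100, 11), (010100, 12), (000110, 13), (010110, 14), (111210, 15), (000111, 16),
     (010111, 17), (111211, 18), (111221, 19)]),
   (000100, [(010000, 21), (000010, 22), (011110, 23), (000011, 24), (011111, 25), (112221, 26)]),
   (010000, [(000110, 31), (000111, 32), (112321, 33)]),
   (000010, [(000001, 41), (011211, 42)])]

/-- The rows `(r, [(s, sign, monomial), …])` of the structure constants of the special pairs
`(r, s)` that are not extraspecial; the sign is `true` for negative values. -/
def specialCodes : List (ℕ × List (ℕ × Bool × List ℕ)) :=
  [(101000, [(000100, false, [1, 2, 11]), (010100, false, [1, 3, 12]), (000110, false, [1, 4, 13]),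
     (010110, false, [1, 5, 14]), (011210, true, [1, 6, 15]), (000111, false, [1, 7, 16]),
     (010111, false, [1, 8, 17]), (011211, true, [1, 9, 18]), (011221, true, [1, 0, 19])]),
   (000100, [(111110, false, [5, 6, 23]), (111111, false, [8, 9, 25])]),
   (001100, [(010000, false, [11, 12, 21]), (000010, false, [11, 13, 22]),
     (010110, true, [11, 14, 23]), (111110, false, [5, 6, 11, 15, 23]),
     (000011, false, [11, 16, 24]), (010111, true, [11, 17, 25]),
     (111111, false, [8, 9, 11, 18, 25]), (111221, true, [11, 19, 26])]),
   (101100, [(010000, false, [2, 3, 11, 12, 21]), (000010, false, [2, 4, 11, 13, 22]),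
     (010110, true, [2, 6, 11, 14, 23]), (011110, true, [2, 6, 11, 15, 23]),
     (000011, false, [2, 7, 11, 16, 24]), (010111, true, [2, 9, 11, 17, 25]),
     (011111, true, [2, 9, 11, 18, 25]), (011221, false, [2, 0, 11, 19, 26])]),
   (010000, [(001110, false, [13, 14, 31]), (101110, false, [4, 5, 13, 14, 31]),
     (001111, false, [16, 17, 32]), (101111, false, [7, 8, 16, 17, 32])]),
   (010100, [(000010, true, [21, 22, 31]), (001110, false, [13, 14, 21, 23, 31]),
     (101110, false, [4, 6, 13, 14, 21, 23, 31]), (000011, true, [21, 24, 32]),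
     (001111, false, [16, 17, 21, 25, 32]), (101111, false, [7, 9, 16, 17, 21, 25, 32]),
     (112221, true, [21, 26, 33])]),
   (011100, [(000010, true, [12, 14, 21, 22, 31]), (000110, true, [12, 14, 21, 23, 31]),
     (101110, false, [4, 6, 12, 13, 14, 15, 21, 23, 31]), (000011, true, [12, 17, 21, 24, 32]),
     (000111, true, [12, 17, 21, 25, 32]), (101111, false, [7, 9, 12, 16, 17, 18, 21, 25, 32]),
     (111221, false, [12, 19, 21, 26, 33])]),
   (111100, [(000010, true, [3, 5, 12, 14, 21, 22, 31]), (000110, true, [3, 6, 12, 14, 21, 23, 31]),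
     (001110, true, [3, 6, 12, 13, 14, 15, 21, 23, 31]), (000011, true, [3, 8, 12, 17, 21, 24, 32]),
     (000111, true, [3, 9, 12, 17, 21, 25, 32]), (001111, true, [3, 9, 12, 16, 17, 18, 21, 25, 32]),
     (011221, true, [3, 0, 12, 19, 21, 26, 33])]),
   (000010, [(111211, false, [9, 0, 42]), (112211, false, [9, 0, 18, 19, 42])]),
   (000110, [(000001, false, [22, 24, 41]), (011111, true, [22, 25, 42]),
     (111111, true, [8, 0, 22, 25, 42]), (112211, false, [9, 0, 18, 19, 22, 26, 42])]),
   (001110, [(000001, false, [13, 16, 22, 24, 41]), (010111, false, [13, 17, 22, 25, 42]),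
     (111111, true, [8, 0, 13, 19, 22, 25, 42]), (111211, true, [9, 0, 13, 19, 22, 26, 42])]),
   (101110, [(000001, false, [4, 7, 13, 16, 22, 24, 41]),
     (010111, false, [4, 0, 13, 17, 22, 25, 42]), (011111, false, [4, 0, 13, 19, 22, 25, 42]),
     (011211, false, [4, 0, 13, 19, 22, 26, 42])]),
   (010110, [(000001, false, [22, 24, 31, 32, 41]), (001111, false, [16, 17, 22, 25, 31, 32, 42]),
     (101111, false, [7, 0, 16, 17, 22, 25, 31, 32, 42]),
     (112211, false, [9, 0, 18, 19, 22, 26, 31, 33, 42])]),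
   (011110, [(000001, false, [14, 17, 22, 24, 31, 32, 41]),
     (000111, true, [14, 17, 22, 25, 31, 32, 42]),
     (101111, false, [7, 0, 14, 16, 17, 19, 22, 25, 31, 32, 42]),
     (111211, true, [9, 0, 14, 19, 22, 26, 31, 33, 42])]),
   (111110, [(000001, false, [5, 8, 14, 17, 22, 24, 31, 32, 41]),
     (000111, true, [5, 0, 14, 17, 22, 25, 31, 32, 42]),
     (001111, true, [5, 0, 14, 16, 17, 19, 22, 25, 31, 32, 42]),
     (011211, false, [5, 0, 14, 19, 22, 26, 31, 33, 42])]),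
   (011210, [(000001, false, [14, 17, 22, 23, 24, 25, 31, 32, 41]),
     (000011, false, [14, 17, 22, 23, 24, 25, 31, 32, 42]),
     (101111, false, [7, 0, 14, 16, 17, 19, 22, 23, 25, 26, 31, 32, 42]),
     (111111, false, [8, 0, 14, 19, 22, 23, 25, 26, 31, 33, 42])]),
   (111210, [(000001, false, [6, 9, 14, 17, 22, 23, 24, 25, 31, 32, 41]),
     (000011, false, [6, 0, 14, 17, 22, 23, 24, 25, 31, 32, 42]),
     (001111, true, [6, 0, 14, 16, 17, 19, 22, 23, 25, 26, 31, 32, 42]),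
     (011111, true, [6, 0, 14, 19, 22, 23, 25, 26, 31, 33, 42])]),
   (112210, [(000001, false, [6, 9, 14, 15, 17, 18, 22, 23, 24, 25, 31, 32, 41]),
     (000011, false, [6, 0, 14, 15, 17, 19, 22, 23, 24, 25, 31, 32, 42]),
     (000111, false, [6, 0, 14, 15, 17, 19, 22, 23, 25, 26, 31, 32, 42]),
     (010111, false, [6, 0, 14, 15, 17, 19, 22, 23, 25, 26, 31, 33, 42])])]

/-- The rows `(r, [(s, sign, monomial), …])` of the structure constants of the pairs `(r, -s)`. -/
def differenceCodes : List (ℕ × List (ℕ × Bool × List ℕ)) :=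
  [(100000, [(101000, true, [1]), (101100, true, [2]), (111100, true, [3]), (101110, true, [4]),
     (111110, true, [5]), (111210, true, [6]), (101111, true, [7]), (111111, true, [8]),
     (111211, true, [9]), (111221, true, [0])]),
   (001000, [(101000, false, [1]), (001100, true, [11]), (011100, true, [12]), (001110, true, [13]),
     (011110, true, [14]), (112210, true, [15]), (001111, true, [16]), (011111, true, [17]),
     (112211, true, [18]), (112221, true, [19])]),
   (101000, [(101100, true, [1, 2, 11]), (111100, true, [1, 3, 12]), (101110, true, [1, 4, 13]),
     (111110, true, [1, 5, 14]), (112210, false, [1, 6, 15]), (101111, true, [1, 7, 16]),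
     (111111, true, [1, 8, 17]), (112211, false, [1, 9, 18]), (112221, false, [1, 0, 19])]),
   (000100, [(001100, false, [11]), (101100, false, [1, 2, 11]), (010100, true, [21]),
     (000110, true, [22]), (011210, true, [23]), (111210, true, [5, 6, 23]), (000111, true, [24]),
     (011211, true, [25]), (111211, true, [8, 9, 25]), (112321, true, [26])]),
   (001100, [(101100, false, [2]), (011100, true, [11, 12, 21]), (001110, true, [11, 13, 22]),
     (011210, false, [11, 14, 23]), (112210, true, [5, 6, 11, 15, 23]),
     (001111, true, [11, 16, 24]), (011211, false, [11, 17, 25]),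
     (112211, true, [8, 9, 11, 18, 25]), (112321, false, [11, 19, 26])]),
   (101100, [(111100, true, [2, 3, 11, 12, 21]), (101110, true, [2, 4, 11, 13, 22]),
     (111210, false, [2, 6, 11, 14, 23]), (112210, false, [2, 6, 11, 15, 23]),
     (101111, true, [2, 7, 11, 16, 24]), (111211, false, [2, 9, 11, 17, 25]),
     (112211, false, [2, 9, 11, 18, 25]), (112321, true, [2, 0, 11, 19, 26])]),
   (010000, [(010100, false, [21]), (011100, false, [11, 12, 21]),
     (111100, false, [2, 3, 11, 12, 21]), (010110, true, [31]), (011110, true, [13, 14, 31]),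
     (111110, true, [4, 5, 13, 14, 31]), (010111, true, [32]), (011111, true, [16, 17, 32]),
     (111111, true, [7, 8, 16, 17, 32]), (122321, true, [33])]),
   (010100, [(011100, false, [12]), (111100, false, [1, 3, 12]), (010110, false, [21, 22, 31]),
     (011210, true, [13, 14, 21, 23, 31]), (111210, true, [4, 6, 13, 14, 21, 23, 31]),
     (010111, false, [21, 24, 32]), (011211, true, [16, 17, 21, 25, 32]),
     (111211, true, [7, 9, 16, 17, 21, 25, 32]), (122321, false, [21, 26, 33])]),
   (011100, [(111100, false, [3]), (011110, false, [12, 14, 21, 22, 31]),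
     (011210, false, [12, 14, 21, 23, 31]), (112210, true, [4, 6, 12, 13, 14, 15, 21, 23, 31]),
     (011111, false, [12, 17, 21, 24, 32]), (011211, false, [12, 17, 21, 25, 32]),
     (112211, true, [7, 9, 12, 16, 17, 18, 21, 25, 32]), (122321, true, [12, 19, 21, 26, 33])]),
   (111100, [(111110, false, [3, 5, 12, 14, 21, 22, 31]),
     (111210, false, [3, 6, 12, 14, 21, 23, 31]),
     (112210, false, [3, 6, 12, 13, 14, 15, 21, 23, 31]),
     (111111, false, [3, 8, 12, 17, 21, 24, 32]), (111211, false, [3, 9, 12, 17, 21, 25, 32]),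
     (112211, false, [3, 9, 12, 16, 17, 18, 21, 25, 32]),
     (122321, false, [3, 0, 12, 19, 21, 26, 33])]),
   (000010, [(000110, false, [22]), (001110, false, [11, 13, 22]),
     (101110, false, [2, 4, 11, 13, 22]), (010110, true, [21, 22, 31]),
     (011110, true, [12, 14, 21, 22, 31]), (111110, true, [3, 5, 12, 14, 21, 22, 31]),
     (000011, true, [41]), (011221, true, [42]), (111221, true, [9, 0, 42]),
     (112221, true, [9, 0, 18, 19, 42])]),
   (000110, [(001110, false, [13]), (101110, false, [1, 4, 13]), (010110, false, [31]),
     (011210, true, [12, 14, 21, 23, 31]), (111210, true, [3, 6, 12, 14, 21, 23, 31]),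
     (000111, true, [22, 24, 41]), (011221, false, [22, 25, 42]),
     (111221, false, [8, 0, 22, 25, 42]), (112321, true, [9, 0, 18, 19, 22, 26, 42])]),
   (001110, [(101110, false, [4]), (011110, false, [13, 14, 31]),
     (011210, false, [13, 14, 21, 23, 31]), (112210, true, [3, 6, 12, 13, 14, 15, 21, 23, 31]),
     (001111, true, [13, 16, 22, 24, 41]), (011221, true, [13, 17, 22, 25, 42]),
     (112221, false, [8, 0, 13, 19, 22, 25, 42]), (112321, false, [9, 0, 13, 19, 22, 26, 42])]),
   (101110, [(111110, false, [4, 5, 13, 14, 31]), (111210, false, [4, 6, 13, 14, 21, 23, 31]),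
     (112210, false, [4, 6, 12, 13, 14, 15, 21, 23, 31]),
     (101111, true, [4, 7, 13, 16, 22, 24, 41]), (111221, true, [4, 0, 13, 17, 22, 25, 42]),
     (112221, true, [4, 0, 13, 19, 22, 25, 42]), (112321, true, [4, 0, 13, 19, 22, 26, 42])]),
   (010110, [(011110, false, [14]), (111110, false, [1, 5, 14]), (011210, true, [11, 14, 23]),
     (111210, true, [2, 6, 11, 14, 23]), (010111, true, [22, 24, 31, 32, 41]),
     (011221, true, [16, 17, 22, 25, 31, 32, 42]),
     (111221, true, [7, 0, 16, 17, 22, 25, 31, 32, 42]),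
     (122321, true, [9, 0, 18, 19, 22, 26, 31, 33, 42])]),
   (011110, [(111110, false, [5]), (011210, false, [23]), (112210, true, [2, 6, 11, 15, 23]),
     (011111, true, [14, 17, 22, 24, 31, 32, 41]), (011221, false, [14, 17, 22, 25, 31, 32, 42]),
     (112221, true, [7, 0, 14, 16, 17, 19, 22, 25, 31, 32, 42]),
     (122321, false, [9, 0, 14, 19, 22, 26, 31, 33, 42])]),
   (111110, [(111210, false, [5, 6, 23]), (112210, false, [5, 6, 11, 15, 23]),
     (111111, true, [5, 8, 14, 17, 22, 24, 31, 32, 41]),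
     (111221, false, [5, 0, 14, 17, 22, 25, 31, 32, 42]),
     (112221, false, [5, 0, 14, 16, 17, 19, 22, 25, 31, 32, 42]),
     (122321, true, [5, 0, 14, 19, 22, 26, 31, 33, 42])]),
   (011210, [(111210, false, [6]), (112210, true, [1, 6, 15]),
     (011211, true, [14, 17, 22, 23, 24, 25, 31, 32, 41]),
     (011221, true, [14, 17, 22, 23, 24, 25, 31, 32, 42]),
     (112321, true, [7, 0, 14, 16, 17, 19, 22, 23, 25, 26, 31, 32, 42]),
     (122321, true, [8, 0, 14, 19, 22, 23, 25, 26, 31, 33, 42])]),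
   (111210, [(112210, false, [15]), (111211, true, [6, 9, 14, 17, 22, 23, 24, 25, 31, 32, 41]),
     (111221, true, [6, 0, 14, 17, 22, 23, 24, 25, 31, 32, 42]),
     (112321, false, [6, 0, 14, 16, 17, 19, 22, 23, 25, 26, 31, 32, 42]),
     (122321, false, [6, 0, 14, 19, 22, 23, 25, 26, 31, 33, 42])]),
   (112210, [(112211, true, [6, 9, 14, 15, 17, 18, 22, 23, 24, 25, 31, 32, 41]),
     (112221, true, [6, 0, 14, 15, 17, 19, 22, 23, 24, 25, 31, 32, 42]),
     (112321, true, [6, 0, 14, 15, 17, 19, 22, 23, 25, 26, 31, 32, 42]),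
     (122321, true, [6, 0, 14, 15, 17, 19, 22, 23, 25, 26, 31, 33, 42])]),
   (000001, [(000011, false, [41]), (000111, false, [22, 24, 41]),
     (001111, false, [13, 16, 22, 24, 41]), (101111, false, [4, 7, 13, 16, 22, 24, 41]),
     (010111, false, [22, 24, 31, 32, 41]), (011111, false, [14, 17, 22, 24, 31, 32, 41]),
     (111111, false, [5, 8, 14, 17, 22, 24, 31, 32, 41]),
     (011211, false, [14, 17, 22, 23, 24, 25, 31, 32, 41]),
     (111211, false, [6, 9, 14, 17, 22, 23, 24, 25, 31, 32, 41]),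
     (112211, false, [6, 9, 14, 15, 17, 18, 22, 23, 24, 25, 31, 32, 41])]),
   (000011, [(000111, false, [24]), (001111, false, [11, 16, 24]),
     (101111, false, [2, 7, 11, 16, 24]), (010111, true, [21, 24, 32]),
     (011111, true, [12, 17, 21, 24, 32]), (111111, true, [3, 8, 12, 17, 21, 24, 32]),
     (011221, false, [14, 17, 22, 23, 24, 25, 31, 32, 42]),
     (111221, false, [6, 0, 14, 17, 22, 23, 24, 25, 31, 32, 42]),
     (112221, false, [6, 0, 14, 15, 17, 19, 22, 23, 24, 25, 31, 32, 42])]),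
   (000111, [(001111, false, [16]), (101111, false, [1, 7, 16]), (010111, false, [32]),
     (011211, true, [12, 17, 21, 25, 32]), (111211, true, [3, 9, 12, 17, 21, 25, 32]),
     (011221, true, [14, 17, 22, 25, 31, 32, 42]),
     (111221, true, [5, 0, 14, 17, 22, 25, 31, 32, 42]),
     (112321, false, [6, 0, 14, 15, 17, 19, 22, 23, 25, 26, 31, 32, 42])]),
   (001111, [(101111, false, [7]), (011111, false, [16, 17, 32]),
     (011211, false, [16, 17, 21, 25, 32]), (112211, true, [3, 9, 12, 16, 17, 18, 21, 25, 32]),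
     (011221, false, [16, 17, 22, 25, 31, 32, 42]),
     (112221, true, [5, 0, 14, 16, 17, 19, 22, 25, 31, 32, 42]),
     (112321, true, [6, 0, 14, 16, 17, 19, 22, 23, 25, 26, 31, 32, 42])]),
   (101111, [(111111, false, [7, 8, 16, 17, 32]), (111211, false, [7, 9, 16, 17, 21, 25, 32]),
     (112211, false, [7, 9, 12, 16, 17, 18, 21, 25, 32]),
     (111221, false, [7, 0, 16, 17, 22, 25, 31, 32, 42]),
     (112221, false, [7, 0, 14, 16, 17, 19, 22, 25, 31, 32, 42]),
     (112321, false, [7, 0, 14, 16, 17, 19, 22, 23, 25, 26, 31, 32, 42])]),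
   (010111, [(011111, false, [17]), (111111, false, [1, 8, 17]), (011211, true, [11, 17, 25]),
     (111211, true, [2, 9, 11, 17, 25]), (011221, false, [13, 17, 22, 25, 42]),
     (111221, false, [4, 0, 13, 17, 22, 25, 42]),
     (122321, false, [6, 0, 14, 15, 17, 19, 22, 23, 25, 26, 31, 33, 42])]),
   (011111, [(111111, false, [8]), (011211, false, [25]), (112211, true, [2, 9, 11, 18, 25]),
     (011221, true, [22, 25, 42]), (112221, false, [4, 0, 13, 19, 22, 25, 42]),
     (122321, true, [6, 0, 14, 19, 22, 23, 25, 26, 31, 33, 42])]),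
   (111111, [(111211, false, [8, 9, 25]), (112211, false, [8, 9, 11, 18, 25]),
     (111221, true, [8, 0, 22, 25, 42]), (112221, true, [8, 0, 13, 19, 22, 25, 42]),
     (122321, false, [8, 0, 14, 19, 22, 23, 25, 26, 31, 33, 42])]),
   (011211, [(111211, false, [9]), (112211, true, [1, 9, 18]), (011221, false, [42]),
     (112321, false, [4, 0, 13, 19, 22, 26, 42]),
     (122321, false, [5, 0, 14, 19, 22, 26, 31, 33, 42])]),
   (111211, [(112211, false, [18]), (111221, false, [9, 0, 42]),
     (112321, true, [9, 0, 13, 19, 22, 26, 42]),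
     (122321, true, [9, 0, 14, 19, 22, 26, 31, 33, 42])]),
   (112211, [(112221, false, [9, 0, 18, 19, 42]), (112321, false, [9, 0, 18, 19, 22, 26, 42]),
     (122321, false, [9, 0, 18, 19, 22, 26, 31, 33, 42])]),
   (011221, [(111221, false, [0]), (112221, true, [1, 0, 19]), (112321, false, [2, 0, 11, 19, 26]),
     (122321, true, [3, 0, 12, 19, 21, 26, 33])]),
   (111221, [(112221, false, [19]), (112321, true, [11, 19, 26]),
     (122321, false, [12, 19, 21, 26, 33])]),
   (112221, [(112321, false, [26]), (122321, true, [21, 26, 33])]),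
   (112321, [(122321, false, [33])])]

/-- The entries of a table given by rows. -/
def entries {A : Type*} (T : List (ℕ × List (ℕ × A))) : List (ℕ × ℕ × A) :=
  T.flatMap fun r => r.2.map fun s => (r.1, s.1, s.2)

/-- The value of the parameter with a given code; the code `50` stands for the sign `-1`. -/
def parameter (α β γ δ ε : ℕ → ℤ) (c : ℕ) : ℤ :=
  ([α, β, γ, δ, ε].getD (c / 10) fun _ => -1) (c % 10)

/-- The value of a signed monomial. -/
def signedProd (θ : ℕ → ℤ) (b : Bool) (l : List ℕ) : ℤ :=
  bif b then -l.tail.foldl (fun x c => x * θ c) (θ (l.headD 50))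
    else l.tail.foldl (fun x c => x * θ c) (θ (l.headD 50))

section Tables

variable {V : Type*} [AddCommGroup V] (p : Fin 6 → V) (α β γ δ ε : ℕ → ℤ)

theorem table2_eq : table2 p α β γ δ ε = extraspecialCodes.map fun r => (ofDigits p r.1,
    r.2.map fun s => (ofDigits p s.1, parameter α β γ δ ε s.2)) := rfl

-- `signedProd` folds from the left, starting at the first factor rather than at 1. Its products
-- thus have the bracketing of the table entries, and the comparison is definitional.
set_option maxRecDepth 10000 in
theorem table3_eq : table3 p α β γ δ ε = specialCodes.map fun r => (ofDigits p r.1,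
    r.2.map fun s => (ofDigits p s.1, signedProd (parameter α β γ δ ε) s.2.1 s.2.2)) := rfl

set_option maxRecDepth 10000 in
theorem table4_eq : table4 p α β γ δ ε = differenceCodes.map fun r => (ofDigits p r.1,
    r.2.map fun s => (-ofDigits p s.1, signedProd (parameter α β γ δ ε) s.2.1 s.2.2)) := rfl

end Tables

/-! ### Signed monomials as exponent vectors modulo 2. -/

section Masks

variable {θ : ℕ → ℤ}

/-- The bit mask of a signed monomial. -/
def mask (b : Bool) (l : List ℕ) : ℕ := l.foldr (fun c a => 2 ^ c ^^^ a) (bif b then 2 ^ 50 else 0)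

/-- The product of the `θ c` over the bits `c` of a mask. -/
def evalMask (θ : ℕ → ℤ) (a : ℕ) : ℤ := ∏ c ∈ Finset.range 51, if a.testBit c then θ c else 1

theorem evalMask_zero : evalMask θ 0 = 1 := by simp [evalMask]

theorem evalMask_two_pow {c : ℕ} (hc : c < 51) : evalMask θ (2 ^ c) = θ c := by
  simp [evalMask, Nat.testBit_two_pow, hc]

/-- Since each parameter squares to 1, a factor occurring in both masks cancels. Equal masks
therefore give equal values, whatever the parameters are. -/
theorem evalMask_xor (hθ : ∀ c, θ c * θ c = 1) (a b : ℕ) :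
    evalMask θ (a ^^^ b) = evalMask θ a * evalMask θ b := by
  rw [evalMask, evalMask, evalMask, ← Finset.prod_mul_distrib]
  refine Finset.prod_congr rfl fun c _ => ?_
  rw [Nat.testBit_xor]
  cases a.testBit c <;> cases b.testBit c <;> simp [hθ]

theorem foldl_mul_eq (x : ℤ) (l : List ℕ) :
    l.foldl (fun x c => x * θ c) x = x * (l.map θ).prod := by
  induction l generalizing x with
  | nil => simp
  | cons c l ih => simp [ih, mul_assoc]

theorem signedProd_eq (b : Bool) {l : List ℕ} (hl : l ≠ []) :
    signedProd θ b l = (bif b then -1 else 1) * (l.map θ).prod := by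
  obtain ⟨c, l, rfl⟩ := List.exists_cons_of_ne_nil hl
  cases b <;> simp [signedProd, foldl_mul_eq]

theorem signedProd_not (b : Bool) (l : List ℕ) : signedProd θ (!b) l = -signedProd θ b l := by
  cases b <;> simp [signedProd]

/-- Two families of parameters appear because `θ` must square to 1 at every index, while the family
in the tables is controlled only at the codes that occur. -/
theorem evalMask_mask (hθ : ∀ c, θ c * θ c = 1) (h50 : θ 50 = -1) {η : ℕ → ℤ} (b : Bool)
    {l : List ℕ} (hl : l ≠ []) (h : ∀ c ∈ l, c < 51 ∧ θ c = η c) :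
    evalMask θ (mask b l) = signedProd η b l := by
  rw [signedProd_eq b hl]
  clear hl
  induction l with
  | nil =>
    cases b
    · simp [mask, evalMask_zero]
    · exact (evalMask_two_pow (by norm_num)).trans h50
  | cons c l ih =>
    have hc := h c (by simp)
    have ih := ih fun d hd => h d (by simp [hd])
    rw [mask, List.foldr_cons, evalMask_xor hθ, evalMask_two_pow hc.1, ← mask, ih, hc.2,
      List.map_cons, List.prod_cons]
    ring

end Masks

/-! ### The recursion for the structure constants and its comparison with the tables. -/

/-- The mask of `N_{n,m}`, computed from the extraspecial pair with the same sum by the Jacobi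
identity; the first argument bounds the depth of the recursion. -/
def structureMask : ℕ → ℕ → ℕ → Option ℕ
  | 0, _, _ => none
  | k + 1, n, m =>
    match (entries extraspecialCodes).find? fun q => q.1 + q.2.1 == n + m with
    | none => none
    | some (r, s, c) =>
      if n = r ∧ m = s then some (2 ^ c)
      else if n = s ∧ m = r then some (2 ^ 50 ^^^ 2 ^ c)
      -- With x = m - r, the Jacobi identity for r, x, n has no term from r + n and gives N(n, m) =
      -- -N(r, s) N(x, n) N(r, x). The inequality guards the truncated subtraction.
      else if r < m ∧ m - r ∈ positiveCodes ∧ r + n ∉ positiveCodes then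
        Option.map₂ (fun a b => 2 ^ 50 ^^^ 2 ^ c ^^^ a ^^^ b)
          (structureMask k (m - r) n) (structureMask k r (m - r))
      -- The previous case with n and m exchanged; antisymmetry cancels the sign bit.
      else if r < n ∧ n - r ∈ positiveCodes ∧ r + m ∉ positiveCodes then
        Option.map₂ (fun a b => 2 ^ c ^^^ a ^^^ b)
          (structureMask k (n - r) m) (structureMask k r (n - r))
      else none

theorem mem_of_extraspecial : ∀ q ∈ entries extraspecialCodes, q.1 ∈ positiveCodes ∧
    q.2.1 ∈ positiveCodes ∧ q.1 + q.2.1 ∈ positiveCodes ∧ Precedes q.1 q.2.1 ∧ q.2.2 < 50 := by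
  decide +kernel

theorem extraspecial_iff : ∀ n ∈ positiveCodes, ∀ m ∈ positiveCodes, n + m ∈ positiveCodes →
    Precedes n m → ((∀ n' ∈ positiveCodes, ∀ m' ∈ positiveCodes, n' + m' = n + m →
      Precedes n' m' → n = n' ∨ Precedes n n') ↔
      ∃ q ∈ entries extraspecialCodes, n = q.1 ∧ m = q.2.1) := by
  decide +kernel

/-- The depth 11 is the height of the highest root 122321. It suffices because each recursive call
lowers the height of the sum. -/
theorem special_spec : ∀ q ∈ entries specialCodes, q.1 ∈ positiveCodes ∧
    q.2.1 ∈ positiveCodes ∧ q.1 + q.2.1 ∈ positiveCodes ∧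
    structureMask 11 q.1 q.2.1 = some (mask q.2.2.1 q.2.2.2) ∧ q.2.2.2 ≠ [] ∧
    ∀ c ∈ q.2.2.2, ∃ q' ∈ entries extraspecialCodes, c = q'.2.2 := by
  decide +kernel

/-- The entry for (r, -s) is -N(r, s - r), hence the negated sign bit. -/
theorem difference_spec : ∀ q ∈ entries differenceCodes, q.1 ∈ positiveCodes ∧
    q.2.1 ∈ positiveCodes ∧ q.1 < q.2.1 ∧ q.2.1 - q.1 ∈ positiveCodes ∧
    structureMask 11 q.1 (q.2.1 - q.1) = some (mask (!q.2.2.1) q.2.2.2) ∧ q.2.2.2 ≠ [] ∧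
    ∀ c ∈ q.2.2.2, ∃ q' ∈ entries extraspecialCodes, c = q'.2.2 := by
  decide +kernel

theorem exists_special : ∀ n ∈ positiveCodes, ∀ m ∈ positiveCodes, n + m ∈ positiveCodes →
    Precedes n m → (∃ q ∈ entries extraspecialCodes, n = q.1 ∧ m = q.2.1) ∨
      ∃ q ∈ entries specialCodes, n = q.1 ∧ m = q.2.1 := by
  decide +kernel

theorem not_precedes_add : ∀ n ∈ positiveCodes, ∀ m ∈ positiveCodes, n + m ∈ positiveCodes →
    ¬ Precedes (n + m) n := by
  decide +kernel

theorem exists_difference : ∀ n ∈ positiveCodes, ∀ m ∈ positiveCodes, n + m ∈ positiveCodes →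
    Precedes n (n + m) → ∃ q ∈ entries differenceCodes, n = q.1 ∧ n + m = q.2.1 := by
  decide +kernel

/-- Soundness of the recursion for any antisymmetric, sign-valued function satisfying the three-root
identity. Whether the recursion succeeds is left to the finite checks. -/
theorem eq_evalMask_of_structureMask {θ : ℕ → ℤ} (hθ : ∀ c, θ c * θ c = 1) (h50 : θ 50 = -1)
    {M : ℕ → ℕ → ℤ} (hext : ∀ q ∈ entries extraspecialCodes, M q.1 q.2.1 = θ q.2.2)
    (hswap : ∀ n m, M m n = -M n m)
    (hone : ∀ n ∈ positiveCodes, ∀ m ∈ positiveCodes, n + m ∈ positiveCodes →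
      M n m * M n m = 1)
    (hjac : ∀ r ∈ positiveCodes, ∀ x ∈ positiveCodes, ∀ n ∈ positiveCodes,
      r + n ∉ positiveCodes → r + x ∈ positiveCodes → x + n ∈ positiveCodes →
      r + x + n ∈ positiveCodes → M x n * M r (x + n) + M r x * M n (r + x) = 0)
    (k : ℕ) {n m a : ℕ} (hn : n ∈ positiveCodes) (hm : m ∈ positiveCodes)
    (hnm : n + m ∈ positiveCodes) (h : structureMask k n m = some a) : M n m = evalMask θ a := by
  induction k generalizing n m a with
  | zero => simp [structureMask] at h
  | succ k ih =>
    rw [structureMask] at h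
    split at h
    · simp at h
    · rename_i r s c hf
      have hq := List.mem_of_find?_eq_some hf
      have hsum : r + s = n + m := by simpa using List.find?_some hf
      obtain ⟨hr, hs, hrs, -, hc⟩ := mem_of_extraspecial _ hq
      have hM : M r s = θ c := hext _ hq
      simp only at hr hs hrs hc
      have hc' : c < 51 := by omega
      have step : ∀ n x a b, n ∈ positiveCodes → x ∈ positiveCodes → x + n = s →
          r + x ∈ positiveCodes → r + n ∉ positiveCodes → structureMask k x n = some a →
          structureMask k r x = some b →
          M n (r + x) = evalMask θ (2 ^ 50 ^^^ 2 ^ c ^^^ a ^^^ b) := by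
        intro n x a b hn hx hxn hrx hrn ha hb
        have h1 := hjac r hr x hx n hn hrn hrx (hxn ▸ hs) (by rwa [add_assoc, hxn])
        have h2 := hone r hr x hx hrx
        rw [evalMask_xor hθ, evalMask_xor hθ, evalMask_xor hθ, evalMask_two_pow (by norm_num),
          evalMask_two_pow hc', h50, ← ih hx hn (hxn ▸ hs) ha, ← ih hr hx hrx hb, ← hM]
        rw [hxn] at h1
        -- Multiply the Jacobi relation by N(r, x) and use that N(r, x) squares to 1.
        linear_combination M r x * h1 - M n (r + x) * h2
      split_ifs at h with h1 h2 h3 h4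
      · obtain ⟨rfl, rfl⟩ := h1
        rw [← Option.some_inj.1 h, hM, evalMask_two_pow hc']
      · obtain ⟨rfl, rfl⟩ := h2
        rw [← Option.some_inj.1 h, hswap m n, hM, evalMask_xor hθ, evalMask_two_pow hc',
          evalMask_two_pow (by norm_num), h50]
        ring
      · obtain ⟨hlt, hx, hrn⟩ := h3
        obtain ⟨a', b', ha, hb, rfl⟩ := Option.map₂_eq_some_iff.1 h
        have e : r + (m - r) = m := by omega
        have := step n (m - r) a' b' hn hx (by omega) (e.symm ▸ hm) hrn ha hb
        rwa [e] at this
      · obtain ⟨hlt, hx, hrm⟩ := h4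
        obtain ⟨a', b', ha, hb, rfl⟩ := Option.map₂_eq_some_iff.1 h
        have e : r + (n - r) = n := by omega
        have := step m (n - r) a' b' hm hx (by omega) (e.symm ▸ hn) hrm ha hb
        rw [e] at this
        rw [hswap m n, this]
        simp only [evalMask_xor hθ, evalMask_two_pow (show 50 < 51 by norm_num), h50]
        ring

theorem listed_map_iff {V A : Type*} (T : List (ℕ × List (ℕ × A))) (f g : ℕ → V) (h : A → ℤ)
    (x y : V) (v : ℤ) :
    Listed (T.map fun r => (f r.1, r.2.map fun s => (g s.1, h s.2))) x y v ↔
      ∃ q ∈ entries T, x = f q.1 ∧ y = g q.2.1 ∧ v = h q.2.2 := by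
  simp only [Listed, entries, List.mem_map, List.mem_flatMap]
  constructor
  · rintro ⟨l, ⟨r, hr, hrl⟩, hl⟩
    obtain ⟨rfl, rfl⟩ := Prod.mk.inj hrl
    obtain ⟨s, hs, hsv⟩ := List.mem_map.1 hl
    obtain ⟨rfl, rfl⟩ := Prod.mk.inj hsv
    exact ⟨_, ⟨r, hr, s, hs, rfl⟩, rfl, rfl, rfl⟩
  · rintro ⟨q, ⟨r, hr, s, hs, rfl⟩, rfl, rfl, rfl⟩
    exact ⟨_, ⟨r, hr, rfl⟩, List.mem_map.2 ⟨s, hs, rfl⟩⟩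

/-! ### Transfer of the finite checks to roots and structure constants. -/

section RootSystem

variable {L : Type*} [LieRing L] [LieAlgebra ℂ L] [FiniteDimensional ℂ L] [IsKilling ℂ L]
  {H : LieSubalgebra ℂ L} [H.IsCartanSubalgebra]
  {B : (rootSystem H).Base} {σ : Fin 6 ≃ B.support}
  (hσ : ∀ i j, B.cartanMatrix (σ i) (σ j) = CartanMatrix.E₆ i j)
  {p : Fin 6 → Dual ℂ H} (hp : ∀ i, p i = (rootSystem H).root (σ i))

include hσ hp in
theorem isSpecial_iff {x y : Dual ℂ H} : IsSpecial (Set.range (rootSystem H).root) p x y ↔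
    ∃ n ∈ positiveCodes, ∃ m ∈ positiveCodes, n + m ∈ positiveCodes ∧ Precedes n m ∧
      x = ofDigits p n ∧ y = ofDigits p m := by
  have hli := linearIndependent_simple hp
  constructor
  · rintro ⟨hx, hy, hxy, h0, h⟩
    rw [← ofDigits_zero p] at h0
    obtain ⟨n, hn, rfl⟩ := eq_ofDigits_of_prec hσ hp hx h0
    obtain ⟨m, hm, rfl⟩ := eq_ofDigits_of_prec hσ hp hy h
    exact ⟨n, hn, m, hm, (ofDigits_add_mem_iff hσ hp hn hm).1 hxy,
      (prec_ofDigits_iff hli n m).1 h, rfl, rfl⟩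
  · rintro ⟨n, hn, m, hm, hnm, h, rfl, rfl⟩
    refine ⟨ofDigits_mem_range_root hσ hp hn, ofDigits_mem_range_root hσ hp hm,
      (ofDigits_add_mem_iff hσ hp hn hm).2 hnm, ?_, (prec_ofDigits_iff hli n m).2 h⟩
    rw [← ofDigits_zero p, prec_ofDigits_iff hli]
    exact precedes_zero n hn

include hσ hp in
theorem isExtraspecial_iff {x y : Dual ℂ H} :
    IsExtraspecial (Set.range (rootSystem H).root) p x y ↔
      ∃ q ∈ entries extraspecialCodes, x = ofDigits p q.1 ∧ y = ofDigits p q.2.1 := by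
  have hli := linearIndependent_simple hp
  have key : ∀ n ∈ positiveCodes, ∀ m ∈ positiveCodes,
      ((∀ r' s', IsSpecial (Set.range (rootSystem H).root) p r' s' →
          r' + s' = ofDigits p n + ofDigits p m → ofDigits p n = r' ∨ Prec p (ofDigits p n) r') ↔
        ∀ n' ∈ positiveCodes, ∀ m' ∈ positiveCodes, n' + m' = n + m → Precedes n' m' →
          n + m ∈ positiveCodes → n = n' ∨ Precedes n n') := by
    intro n hn m hm
    have ln := lt_of_mem n hn
    have lm := lt_of_mem m hm
    constructor
    · intro h n' hn' m' hm' hsum hlt hnm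
      have ln' := lt_of_mem n' hn'
      have := h _ _ ((isSpecial_iff hσ hp).2 ⟨n', hn', m', hm', hsum ▸ hnm, hlt, rfl, rfl⟩)
        (by rw [← ofDigits_add p hn' hm', hsum, ofDigits_add p hn hm])
      rwa [ofDigits_inj_of_lt hp (by omega) (by omega), prec_ofDigits_iff hli] at this
    · intro h r' s' hs hsum
      obtain ⟨n', hn', m', hm', hnm', hlt, rfl, rfl⟩ := (isSpecial_iff hσ hp).1 hs
      have ln' := lt_of_mem n' hn'
      have lm' := lt_of_mem m' hm'
      rw [← ofDigits_add p hn' hm', ← ofDigits_add p hn hm,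
        ofDigits_inj_of_lt hp (by omega) (by omega)] at hsum
      rw [ofDigits_inj_of_lt hp (by omega) (by omega), prec_ofDigits_iff hli]
      exact h n' hn' m' hm' hsum hlt (hsum ▸ hnm')
  constructor
  · rintro ⟨hs, h⟩
    obtain ⟨n, hn, m, hm, hnm, hlt, rfl, rfl⟩ := (isSpecial_iff hσ hp).1 hs
    obtain ⟨q, hq, rfl, rfl⟩ := (extraspecial_iff n hn m hm hnm hlt).1
      fun n' hn' m' hm' h1 h2 => (key n hn m hm).1 h n' hn' m' hm' h1 h2 hnm
    exact ⟨q, hq, rfl, rfl⟩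
  · rintro ⟨q, hq, rfl, rfl⟩
    obtain ⟨hn, hm, hnm, hlt, -⟩ := mem_of_extraspecial q hq
    exact ⟨(isSpecial_iff hσ hp).2 ⟨_, hn, _, hm, hnm, hlt, rfl, rfl⟩, (key _ hn _ hm).2
      fun n' hn' m' hm' h1 h2 _ =>
        (extraspecial_iff _ hn _ hm hnm hlt).2 ⟨q, hq, rfl, rfl⟩ n' hn' m' hm' h1 h2⟩

variable (C : ChevalleyBasis H)

include hσ hp in
theorem N_ofDigits_eq_one_or {n m : ℕ} (hn : n ∈ positiveCodes) (hm : m ∈ positiveCodes)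
    (hnm : n + m ∈ positiveCodes) :
    C.N (ofDigits p n) (ofDigits p m) = 1 ∨ C.N (ofDigits p n) (ofDigits p m) = -1 :=
  C.N_eq_one_or (sub_notMem_of_add_mem hσ hp) (ofDigits_mem_range_root hσ hp hn)
    (ofDigits_mem_range_root hσ hp hm) ((ofDigits_add_mem_iff hσ hp hn hm).2 hnm)

include hσ hp in
-- Since r + n is not a root, the Jacobi identity loses one of its three terms.
theorem N_ofDigits_jacobi {r x n : ℕ} (hr : r ∈ positiveCodes) (hx : x ∈ positiveCodes)
    (hn : n ∈ positiveCodes) (hrn : r + n ∉ positiveCodes) (hrx : r + x ∈ positiveCodes)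
    (hrxn : r + x + n ∈ positiveCodes) :
    C.N (ofDigits p x) (ofDigits p n) * C.N (ofDigits p r) (ofDigits p (x + n)) +
      C.N (ofDigits p r) (ofDigits p x) * C.N (ofDigits p n) (ofDigits p (r + x)) = 0 := by
  have hne : ∀ {a b : ℕ}, a ∈ positiveCodes → b ∈ positiveCodes →
      ofDigits p a + ofDigits p b ≠ 0 := by
    intro a b ha hb h0
    have la := lt_of_mem a ha
    have lb := lt_of_mem b hb
    rw [← ofDigits_add p ha hb, ← ofDigits_zero p,
      ofDigits_inj_of_lt hp (by omega) (by omega)] at h0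
    omega
  have h := C.N_jacobi (hne hr hx) (hne hx hn) (hne hn hr) (by
    rw [← ofDigits_add p hr hx, ← ofDigits_add p hrx hn]
    exact ofDigits_mem_range_root hσ hp hrxn)
  rw [C.N_eq_zero (ofDigits p n) (ofDigits p r), zero_mul, add_zero, ← ofDigits_add p hx hn,
    ← ofDigits_add p hr hx] at h
  · exact h
  · rintro ⟨-, -, h'⟩
    rw [ofDigits_add_mem_iff hσ hp hn hr, add_comm] at h'
    exact hrn h'

include hσ hp in
theorem N_eq_signedProd {θ : ℕ → ℤ} (h50 : θ 50 = -1)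
    (hext : ∀ q ∈ entries extraspecialCodes,
      C.N (ofDigits p q.1) (ofDigits p q.2.1) = θ q.2.2)
    {k n m : ℕ} {b : Bool} {l : List ℕ} (hn : n ∈ positiveCodes) (hm : m ∈ positiveCodes)
    (hnm : n + m ∈ positiveCodes) (h : structureMask k n m = some (mask b l)) (hl : l ≠ [])
    (hc : ∀ c ∈ l, ∃ q ∈ entries extraspecialCodes, c = q.2.2) :
    C.N (ofDigits p n) (ofDigits p m) = signedProd θ b l := by
  have hone : ∀ n ∈ positiveCodes, ∀ m ∈ positiveCodes, n + m ∈ positiveCodes →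
      C.N (ofDigits p n) (ofDigits p m) * C.N (ofDigits p n) (ofDigits p m) = 1 := by
    intro n hn m hm hnm
    rcases N_ofDigits_eq_one_or hσ hp C hn hm hnm with h | h <;> rw [h] <;> norm_num
  -- The parameters are arbitrary at indices not naming an extraspecial value. Replacing every value
  -- that does not square to 1 by 1 leaves the extraspecial ones unchanged, since these are signs.
  let η : ℕ → ℤ := fun c => if θ c * θ c = 1 then θ c else 1
  have hη : ∀ c, η c * η c = 1 := by
    intro c
    by_cases h : θ c * θ c = 1 <;> simp [η, h]
  have hηθ : ∀ q ∈ entries extraspecialCodes, η q.2.2 = θ q.2.2 := by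
    intro q hq
    obtain ⟨h1, h2, h3, -, -⟩ := mem_of_extraspecial q hq
    exact if_pos (by rw [← hext q hq, hone _ h1 _ h2 h3])
  have hη50 : η 50 = -1 := by simp [η, h50]
  rw [eq_evalMask_of_structureMask hη hη50
    (M := fun n m => C.N (ofDigits p n) (ofDigits p m))
    (fun q hq => by rw [hext q hq, hηθ q hq]) (fun n m => C.N_swap _ _) hone
    (fun r hr x hx n hn hrn hrx _ => N_ofDigits_jacobi hσ hp C hr hx hn hrn hrx) k hn hm hnm h]
  refine evalMask_mask hη hη50 b hl fun c h => ?_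
  obtain ⟨q, hq, rfl⟩ := hc c h
  exact ⟨(mem_of_extraspecial q hq).2.2.2.2.trans (by norm_num), hηθ q hq⟩

include hσ hp in
theorem N_ofDigits_neg {n m : ℕ} (hn : n ∈ positiveCodes) (hm : m ∈ positiveCodes)
    (hnm : n + m ∈ positiveCodes) :
    C.N (ofDigits p n) (-ofDigits p (n + m)) = -C.N (ofDigits p n) (ofDigits p m) := by
  rw [ofDigits_add p hn hm]
  exact C.N_neg_add_right (sub_notMem_of_add_mem hσ hp) (ofDigits_mem_range_root hσ hp hn)
    (ofDigits_mem_range_root hσ hp hm) ((ofDigits_add_mem_iff hσ hp hn hm).2 hnm)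

theorem mem_range_root_of_N_ne_zero {x y : Dual ℂ H} (h : C.N x y ≠ 0) :
    x ∈ Set.range (rootSystem H).root ∧ y ∈ Set.range (rootSystem H).root ∧
      x + y ∈ Set.range (rootSystem H).root := by
  by_contra h'
  exact h (C.N_eq_zero x y h')

include hσ hp in
theorem N_neg_ne_zero_iff {x y : Dual ℂ H} (hx : Prec p 0 x) (hxy : Prec p x y) :
    C.N x (-y) ≠ 0 ↔
      ∃ q ∈ entries differenceCodes, x = ofDigits p q.1 ∧ -y = -ofDigits p q.2.1 := by
  have hli := linearIndependent_simple hp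
  constructor
  · intro h
    obtain ⟨h1, h2, h3⟩ := mem_range_root_of_N_ne_zero C h
    rw [← ofDigits_zero p] at hx
    obtain ⟨n, hn, rfl⟩ := eq_ofDigits_of_prec hσ hp h1 hx
    obtain ⟨m, hm, rfl⟩ := eq_ofDigits_of_prec hσ hp
      ((rootSystem H).neg_mem_range_root_iff.1 h2) hxy
    rw [prec_ofDigits_iff hli] at hxy
    rw [← sub_eq_add_neg, ofDigits_sub_mem_iff hσ hp hm hn] at h3
    obtain ⟨k, hk, rfl | rfl⟩ := h3
    -- A difference of the wrong sign would make x the sum of y and a positive root, contradicting x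
    -- ≺ y.
    · exact absurd hxy (not_precedes_add m hm k hk hn)
    · obtain ⟨q, hq, h1, h2⟩ := exists_difference n hn k hk hm hxy
      exact ⟨q, hq, by rw [h1], by rw [h2]⟩
  · rintro ⟨q, hq, rfl, h⟩
    obtain ⟨h1, h2, hlt, h3, -⟩ := difference_spec q hq
    have e : q.1 + (q.2.1 - q.1) = q.2.1 := by omega
    have := N_ofDigits_neg hσ hp C h1 h3 (by rwa [e])
    rw [e] at this
    rw [h, this]
    rcases N_ofDigits_eq_one_or hσ hp C h1 h3 (by rwa [e]) with h | h <;> rw [h] <;> norm_num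

include hσ hp in
theorem N_ne_zero_iff {x y : Dual ℂ H} (hx : Prec p 0 x) (hxy : Prec p x y) :
    C.N x y ≠ 0 ↔
      (∃ q ∈ entries extraspecialCodes, x = ofDigits p q.1 ∧ y = ofDigits p q.2.1) ∨
      ∃ q ∈ entries specialCodes, x = ofDigits p q.1 ∧ y = ofDigits p q.2.1 := by
  have hne : ∀ {n m : ℕ}, n ∈ positiveCodes → m ∈ positiveCodes → n + m ∈ positiveCodes →
      C.N (ofDigits p n) (ofDigits p m) ≠ 0 := by
    intro n m hn hm hnm
    rcases N_ofDigits_eq_one_or hσ hp C hn hm hnm with h | h <;> rw [h] <;> norm_num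
  constructor
  · intro h
    obtain ⟨h1, h2, h3⟩ := mem_range_root_of_N_ne_zero C h
    obtain ⟨n, hn, m, hm, hnm, hlt, rfl, rfl⟩ :=
      (isSpecial_iff hσ hp).1 ⟨h1, h2, h3, hx, hxy⟩
    rcases exists_special n hn m hm hnm hlt with ⟨q, hq, rfl, rfl⟩ | ⟨q, hq, rfl, rfl⟩
    · exact Or.inl ⟨q, hq, rfl, rfl⟩
    · exact Or.inr ⟨q, hq, rfl, rfl⟩
  · rintro (⟨q, hq, rfl, rfl⟩ | ⟨q, hq, rfl, rfl⟩)
    · obtain ⟨h1, h2, h3, -⟩ := mem_of_extraspecial q hq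
      exact hne h1 h2 h3
    · obtain ⟨h1, h2, h3, -⟩ := special_spec q hq
      exact hne h1 h2 h3

end RootSystem

end E6

end

theorem theorem1 {L : Type*} [LieRing L] [LieAlgebra ℂ L] [FiniteDimensional ℂ L]
    [LieAlgebra.IsSimple ℂ L] (H : LieSubalgebra ℂ L) [H.IsCartanSubalgebra]
    (B : (rootSystem H).Base) (σ : Fin 6 ≃ B.support)
    (hσ : ∀ i j, B.cartanMatrix (σ i) (σ j) = CartanMatrix.E₆ i j)
    (p : Fin 6 → Dual ℂ H) (hp : ∀ i, p i = (rootSystem H).root (σ i))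
    (C : E6.ChevalleyBasis H) (α β γ δ ε : ℕ → ℤ)
    (hN : ∀ r s v, E6.Listed (E6.table2 p α β γ δ ε) r s v → C.N r s = v) :
    (∀ r s, E6.IsExtraspecial (Set.range (rootSystem H).root) p r s ↔
      ∃ v, E6.Listed (E6.table2 p α β γ δ ε) r s v) ∧
    (∀ r s v, E6.Listed (E6.table3 p α β γ δ ε) r s v → C.N r s = v) ∧
    (∀ r s v, E6.Listed (E6.table4 p α β γ δ ε) r s v → C.N r s = v) ∧
    (∀ r s, E6.Prec p 0 r → E6.Prec p r s →
      (C.N r s ≠ 0 ↔ ∃ v, E6.Listed (E6.table2 p α β γ δ ε) r s v ∨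
        E6.Listed (E6.table3 p α β γ δ ε) r s v)) ∧
    (∀ r s, E6.Prec p 0 r → E6.Prec p r s →
      (C.N r (-s) ≠ 0 ↔ ∃ v, E6.Listed (E6.table4 p α β γ δ ε) r (-s) v)) := by
  have h2 := fun x y v => (E6.table2_eq p α β γ δ ε).symm ▸ E6.listed_map_iff E6.extraspecialCodes
    (E6.ofDigits p) (E6.ofDigits p) (E6.parameter α β γ δ ε) x y v
  have h3 := fun x y v => (E6.table3_eq p α β γ δ ε).symm ▸ E6.listed_map_iff E6.specialCodes
    (E6.ofDigits p) (E6.ofDigits p)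
    (fun s => E6.signedProd (E6.parameter α β γ δ ε) s.1 s.2) x y v
  have h4 := fun x y v => (E6.table4_eq p α β γ δ ε).symm ▸ E6.listed_map_iff E6.differenceCodes
    (E6.ofDigits p) (fun n => -E6.ofDigits p n)
    (fun s => E6.signedProd (E6.parameter α β γ δ ε) s.1 s.2) x y v
  have hext : ∀ q ∈ E6.entries E6.extraspecialCodes,
      C.N (E6.ofDigits p q.1) (E6.ofDigits p q.2.1) = E6.parameter α β γ δ ε q.2.2 :=
    fun q hq => hN _ _ _ ((h2 _ _ _).2 ⟨q, hq, rfl, rfl, rfl⟩)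
  have h50 : E6.parameter α β γ δ ε 50 = -1 := rfl
  refine ⟨fun r s => ?_, fun r s v h => ?_, fun r s v h => ?_, fun r s hr hrs => ?_,
    fun r s hr hrs => ?_⟩
  · rw [E6.isExtraspecial_iff hσ hp]
    simp only [h2]
    exact ⟨fun ⟨q, hq, h, h'⟩ => ⟨_, q, hq, h, h', rfl⟩, fun ⟨_, q, hq, h, h', _⟩ => ⟨q, hq, h, h'⟩⟩
  · obtain ⟨q, hq, rfl, rfl, rfl⟩ := (h3 _ _ _).1 h
    obtain ⟨hn, hm, hnm, hmask, hl, hc⟩ := E6.special_spec q hq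
    exact E6.N_eq_signedProd hσ hp C h50 hext hn hm hnm hmask hl hc
  · obtain ⟨q, hq, rfl, rfl, rfl⟩ := (h4 _ _ _).1 h
    obtain ⟨hn, hm, hlt, hd, hmask, hl, hc⟩ := E6.difference_spec q hq
    have e : q.1 + (q.2.1 - q.1) = q.2.1 := by omega
    have h := E6.N_ofDigits_neg hσ hp C hn hd (by rwa [e])
    -- The minus sign from passing to the negative root cancels the negated sign bit in
    -- `difference_spec`.
    rw [e, E6.N_eq_signedProd hσ hp C h50 hext hn hd (by rwa [e]) hmask hl hc,
      E6.signedProd_not, neg_neg] at h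
    exact h
  · rw [E6.N_ne_zero_iff hσ hp C hr hrs]
    simp only [h2, h3]
    constructor
    · rintro (⟨q, hq, h, h'⟩ | ⟨q, hq, h, h'⟩)
      · exact ⟨_, Or.inl ⟨q, hq, h, h', rfl⟩⟩
      · exact ⟨_, Or.inr ⟨q, hq, h, h', rfl⟩⟩
    · rintro ⟨v, ⟨q, hq, h, h', -⟩ | ⟨q, hq, h, h', -⟩⟩
      · exact Or.inl ⟨q, hq, h, h'⟩
      · exact Or.inr ⟨q, hq, h, h'⟩
  · rw [E6.N_neg_ne_zero_iff hσ hp C hr hrs]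
    simp only [h4]
    exact ⟨fun ⟨q, hq, h, h'⟩ => ⟨_, q, hq, h, h', rfl⟩, fun ⟨_, q, hq, h, h', _⟩ => ⟨q, hq, h, h'⟩⟩
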